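/- **Setting.** Let $(V,\eta)$ be a real Lorentzian vector space with $\dim V>2$, let $S$ be a (possibly extended) real spinor module of $\mathfrak{so}(V)$, i.e. a finite-dimensional real module of the even Clifford algebra of $(V,\eta)$, on which $\mathfrak{so}(V)$ acts through the Clifford action, and let $\kappa:\bigodot^2S\to V$ be an $\mathfrak{so}(V)$-equivariant map which is *causal*: for all $s\neq 0$ the vector $\kappa_s:=\kappa(s,s)$ is timelike or null (null vectors being nonzero). The Poincaré superalgebra $\mathfrak s=V\oplus S\oplus\mathfrak{so}(V)$ (degrees $-2,-1,0$) has brackets $[A,B]=AB-BA$, $[A,v]=Av$, $[A,s]=A\cdot s$, $[s,s]=\kappa_s$, $[v,w]=0$, $[v,s]=0$. Let $\mathfrak a=V\oplus S'\oplus\mathfrak h$ be a *highly supersymmetric* graded subalgebra: $\mathfrak h\subseteq\mathfrak{so}(V)$ is a Lie subalgebra preserving the subspace $S'\subseteq S$, and $\dim S'>\tfrac12\dim S$. Write $\mathfrak a_-=V\oplus S'$, $\mathfrak s_-=V\oplus S$. For $\mathfrak n\in\{\mathfrak a_-,\mathfrak s_-\}$ and $\mathfrak m\in\{\mathfrak a,\mathfrak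 s\}$ with $\mathfrak n\subseteq\mathfrak m$ let $C^{2,p}(\mathfrak n;\mathfrak m)$, $Z^{2,p}$, $B^{2,p}$, $H^{2,p}$ be the cochains, cocycles, coboundaries and cohomology of degree $2$ in the Chevalley–Eilenberg (Spencer) complex $\operatorname{Hom}(\bigwedge^p\mathfrak n,\mathfrak m)$ ($\bigwedge^p$ in the super sense), with differential $\partial$; let $i_*:C^{2,2}(\mathfrak a_-;\mathfrak a)\to C^{2,2}(\mathfrak a_-;\mathfrak s)$ and $i^*:C^{2,2}(\mathfrak s_-;\mathfrak s)\to C^{2,2}(\mathfrak a_-;\mathfrak s)$ be induced by the inclusion. Put $$\mathcal H^{2,2}=\{\widehat\beta+\widehat\gamma\in Z^{2,2}(\mathfrak s_-;\mathfrak s)\mid \widehat\beta:V\otimes S\to S,\ \widehat\gamma:\textstyle\bigodot^2S\to\mathfrak{so}(V)\},\qquad \mathcal K^{2,2}(\mathfrak a_-)=\{\widehat\beta+\widehat\gamma\in\mathcal H^{2,2}\mid\widehat\beta|_{V\otimes S'}=0\}.$$ A cocycle $\alpha+\beta+\gamma\in Z^{2,2}(\mathfrak a_-;\mathfrak a)$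 is *admissible* if $i_*[\alpha+\beta+\gamma]=i^*[\widehat\beta+\widehat\gamma]$ in $H^{2,2}(\mathfrak a_-;\mathfrak s)$ for some $\mathfrak h$-invariant $\widehat\beta+\widehat\gamma\in\mathcal H^{2,2}$; equivalently $i_*(\alpha+\beta+\gamma)=i^*(\widehat\beta+\widehat\gamma)+\partial\lambda$ for some linear $\lambda:V\to\mathfrak{so}(V)$. Given such $(\widehat\beta,\widehat\gamma,\lambda)$, define $\Theta:V\otimes\bigodot^2S'\to\mathfrak{so}(V)$ by $$\Theta(v,s,s)=2\widehat\gamma(s,\widehat\beta(v,s))-(\lambda(v)\cdot\widehat\gamma)(s,s).$$ The admissible cocycle is *integrable* if (1) $\Theta$ annihilates $V\otimes\ker(\kappa|_{\bigodot^2S'})$, and (2) the map $\widetilde\theta$ with $\widetilde\theta(v,\kappa_s)=\Theta(v,s,s)$ for $v\in V$, $s\in S'$ satisfies $$\widetilde\theta(v,w)\cdot s=\widehat\beta(v,\widehat\beta(w,s))-\widehat\beta(w,\widehat\beta(v,s))+(\lambda(v)\cdot\widehat\beta)(w,s)-(\lambda(w)\cdot\widehat\beta)(v,s)\qquad(v,w\in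 V,\ s\in S').$$ (These conditions depend only on the cocycle.) A *filtered deformation* of $\mathfrak a$ is a Lie superalgebra bracket on the superspace $\mathfrak a$ which respects the filtration $\mathfrak a^k=\bigoplus_{l\ge k}\mathfrak a_l$ and whose associated graded bracket is that of $\mathfrak a$. It is *geometrically realisable* if the degree-$2$ part of its difference from the bracket of $\mathfrak a$, restricted to $\bigwedge^2\mathfrak a_-$, is an admissible cocycle. Two filtered deformations of $\mathfrak a$ are *isomorphic* if there is an even, strictly filtered isomorphism of Lie superalgebras between them which induces the identity on the associated graded algebra $\mathfrak a$. **Theorem (Integration of admissible cocycles).** Let $\alpha+\beta+\gamma$ be an admissible, integrable Spencer $(2,2)$-cocycle for $\mathfrak a$, with $i_*(\alpha+\beta+\gamma)=i^*(\widehat\beta+\widehat\gamma)+\partial\lambda$, where $\widehat\beta+\widehat\gamma\in\mathcal H^{2,2}$ is $\mathfrak h$-invariant and $\lambda:V\to\mathfrak{so}(V)$ is linear. Then there is a unique bilinear map $\widetilde\theta:V\otimes V\to\mathfrak{so}(V)$ with $\widetilde\theta(v,\kappa_s)=\Theta(v,s,s)$ for all $v\in V$, $s\in S'$; it is alternating;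 and the brackets $$\begin{gathered}[A,B]=AB-BA,\qquad [s,s]=\kappa_s+\widehat\gamma(s,s)-\lambda(\kappa_s),\\ [A,v]=Av+[A,\lambda(v)]-\lambda(Av),\qquad [v,s]=\widehat\beta(v,s)+\lambda(v)\cdot s,\qquad [A,s]=A\cdot s,\\ [v,w]=\lambda(v)w-\lambda(w)v+\widetilde\theta(v,w)-\lambda(\lambda(v)w-\lambda(w)v)+[\lambda(v),\lambda(w)]\end{gathered}$$ ($A,B\in\mathfrak h$, $v,w\in V$, $s\in S'$) take values in $\mathfrak a$ and define a geometrically realisable filtered deformation of $\mathfrak a$. Moreover, two such deformations of $\mathfrak a$, arising from $(\widehat\beta,\widehat\gamma,\lambda)$ and $(\widehat\beta',\widehat\gamma',\lambda')$, are isomorphic if and only if $(\widehat\beta'+\widehat\gamma')-(\widehat\beta+\widehat\gamma)\in\mathcal K^{2,2}(\mathfrak a_-)$. -/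

import Mathlib

attribute [local instance 100] LieRing.ofAssociativeRing

noncomputable section

namespace SpencerDeformation

/-! ### Graded and filtered superspaces, Lie superbrackets, filtered deformations -/

/-- The sign `(-1)^(i j)` attached to two parities. -/
def superSign (i j : ZMod 2) : ℤˣ := if i = 1 ∧ j = 1 then -1 else 1

section Graded

variable {L : Type*} [AddCommGroup L] [Module ℝ L]

/-- The parity-`ε` subspace of a `ℤ`-graded superspace: the sum of the components whose degree
reduces to `ε` modulo `2`. -/
def parityPart (𝒜 : ℤ → Submodule ℝ L) (ε : ZMod 2) : Submodule ℝ L :=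
  ⨆ (k : ℤ) (_ : (k : ZMod 2) = ε), 𝒜 k

/-- The natural decreasing filtration `F^k = ⨁_{l ≥ k} 𝒜_l` of a graded space. -/
def filtrationOf (𝒜 : ℤ → Submodule ℝ L) (k : ℤ) : Submodule ℝ L :=
  ⨆ (l : ℤ) (_ : k ≤ l), 𝒜 l

/-- `b` is a Lie superalgebra bracket on the superspace whose parity components are `𝒢`. -/
structure IsLieSuperbracket (𝒢 : ZMod 2 → Submodule ℝ L) (b : L →ₗ[ℝ] L →ₗ[ℝ] L) : Prop where
  mem : ∀ i j, ∀ x ∈ 𝒢 i, ∀ y ∈ 𝒢 j, b x y ∈ 𝒢 (i + j)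
  skew : ∀ i j, ∀ x ∈ 𝒢 i, ∀ y ∈ 𝒢 j, b x y = -(superSign i j • b y x)
  jacobi : ∀ i j k, ∀ x ∈ 𝒢 i, ∀ y ∈ 𝒢 j, ∀ z ∈ 𝒢 k,
    b x (b y z) = b (b x y) z + superSign i j • b y (b x z)

/-- `b` is a filtered deformation of the graded bracket `b₀` on the graded space `(L, 𝒜)`:
a Lie superbracket on the same superspace which respects the natural filtration and whose
associated graded bracket is `b₀`, i.e. `b x y = b₀ x y + (terms of higher degree)`.  (The
associated graded space of the natural filtration is identified with `L` through `𝒜`.) -/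
structure IsFilteredDeformation (𝒜 : ℤ → Submodule ℝ L) (b₀ b : L →ₗ[ℝ] L →ₗ[ℝ] L) : Prop where
  lie : IsLieSuperbracket (parityPart 𝒜) b
  filtered : ∀ k l, ∀ x ∈ filtrationOf 𝒜 k, ∀ y ∈ filtrationOf 𝒜 l,
    b x y ∈ filtrationOf 𝒜 (k + l)
  gr : ∀ k l, ∀ x ∈ 𝒜 k, ∀ y ∈ 𝒜 l, b x y - b₀ x y ∈ filtrationOf 𝒜 (k + l + 1)

/-- An isomorphism between two filtered deformations `b`, `b'` of one graded Lie superalgebra on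
`(L, 𝒜)`: an even, strictly filtered isomorphism of Lie superalgebras which induces the identity
on the associated graded algebra. -/
structure DeformationIso (𝒜 : ℤ → Submodule ℝ L) (b b' : L →ₗ[ℝ] L →ₗ[ℝ] L) where
  toEquiv : L ≃ₗ[ℝ] L
  map_bracket : ∀ x y, toEquiv (b x y) = b' (toEquiv x) (toEquiv y)
  even : ∀ ε, ∀ x ∈ parityPart 𝒜 ε, toEquiv x ∈ parityPart 𝒜 ε
  strict : ∀ k, (filtrationOf 𝒜 k).map (toEquiv : L →ₗ[ℝ] L) = filtrationOf 𝒜 k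
  gr_id : ∀ k, ∀ x ∈ 𝒜 k, toEquiv x - x ∈ filtrationOf 𝒜 (k + 1)

end Graded

/-! ### The Spencer complex in homological degrees 1 and 2

`N` is the negatively graded superalgebra `𝔤₋` with bracket `br`, acting on the graded module `M`
through `act`.  The signs in the differentials are those for cochains of even degree `d`. -/

section Spencer

variable {N M : Type*} [AddCommGroup N] [Module ℝ N] [AddCommGroup M] [Module ℝ M]
  (𝒩 : ℤ → Submodule ℝ N) (ℳ : ℤ → Submodule ℝ M)
  (br : N →ₗ[ℝ] N →ₗ[ℝ] N) (act : N →ₗ[ℝ] M →ₗ[ℝ] M)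

/-- `C^{d,1}`: linear maps `N → M` of degree `d`. -/
def IsCochain₁ (d : ℤ) (ψ : N →ₗ[ℝ] M) : Prop :=
  ∀ k, ∀ x ∈ 𝒩 k, ψ x ∈ ℳ (k + d)

/-- `C^{d,2}`: maps `⋀² N → M` (exterior square in the super sense) of degree `d`. -/
def IsCochain₂ (d : ℤ) (φ : N →ₗ[ℝ] N →ₗ[ℝ] M) : Prop :=
  ∀ k l : ℤ, ∀ x ∈ 𝒩 k, ∀ y ∈ 𝒩 l,
    φ x y ∈ ℳ (k + l + d) ∧ φ x y = -(superSign k l • φ y x)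

/-- `φ = ∂ψ` for a 1-cochain `ψ` of even degree:
`∂ψ(X,Y) = [X,ψ(Y)] - (-1)^{|X||Y|} [Y,ψ(X)] - ψ([X,Y])`. -/
def IsDifferential₁ (ψ : N →ₗ[ℝ] M) (φ : N →ₗ[ℝ] N →ₗ[ℝ] M) : Prop :=
  ∀ k l : ℤ, ∀ x ∈ 𝒩 k, ∀ y ∈ 𝒩 l,
    φ x y = act x (ψ y) - superSign k l • act y (ψ x) - ψ (br x y)

/-- `∂φ = 0` for a 2-cochain `φ` of even degree. -/
def IsClosed₂ (φ : N →ₗ[ℝ] N →ₗ[ℝ] M) : Prop :=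
  ∀ k l m : ℤ, ∀ x ∈ 𝒩 k, ∀ y ∈ 𝒩 l, ∀ z ∈ 𝒩 m,
    (act x (φ y z) - φ (br x y) z)
      + superSign k (l + m) • (act y (φ z x) - φ (br y z) x)
      + superSign (k + l) m • (act z (φ x y) - φ (br z x) y) = 0

/-- `Z^{d,2}` (for even `d`). -/
def IsCocycle₂ (d : ℤ) (φ : N →ₗ[ℝ] N →ₗ[ℝ] M) : Prop :=
  IsCochain₂ 𝒩 ℳ d φ ∧ IsClosed₂ 𝒩 br act φ

/-- `B^{d,2}` (for even `d`). -/
def IsCoboundary₂ (d : ℤ) (φ : N →ₗ[ℝ] N →ₗ[ℝ] M) : Prop :=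
  ∃ ψ : N →ₗ[ℝ] M, IsCochain₁ 𝒩 ℳ d ψ ∧ IsDifferential₁ 𝒩 br act ψ φ

end Spencer

/-! ### Gradings of `V ⊕ S ⊕ H` (degrees -2, -1, 0) and of `V ⊕ S` (degrees -2, -1) -/

section Gradings

variable (V S H : Type*) [AddCommGroup V] [Module ℝ V] [AddCommGroup S] [Module ℝ S]
  [AddCommGroup H] [Module ℝ H]

def grading (k : ℤ) : Submodule ℝ (V × S × H) where
  carrier := {x | (k ≠ -2 → x.1 = 0) ∧ (k ≠ -1 → x.2.1 = 0) ∧ (k ≠ 0 → x.2.2 = 0)}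
  zero_mem' := by simp
  add_mem' := by
    rintro x y ⟨h1, h2, h3⟩ ⟨h1', h2', h3'⟩
    exact ⟨fun h => by simp [h1 h, h1' h], fun h => by simp [h2 h, h2' h],
      fun h => by simp [h3 h, h3' h]⟩
  smul_mem' := by
    rintro c x ⟨h1, h2, h3⟩
    exact ⟨fun h => by simp [h1 h], fun h => by simp [h2 h], fun h => by simp [h3 h]⟩

def negGrading (k : ℤ) : Submodule ℝ (V × S) where
  carrier := {x | (k ≠ -2 → x.1 = 0) ∧ (k ≠ -1 → x.2 = 0)}
  zero_mem' := by simp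
  add_mem' := by
    rintro x y ⟨h1, h2⟩ ⟨h1', h2'⟩
    exact ⟨fun h => by simp [h1 h, h1' h], fun h => by simp [h2 h, h2' h]⟩
  smul_mem' := by
    rintro c x ⟨h1, h2⟩
    exact ⟨fun h => by simp [h1 h], fun h => by simp [h2 h]⟩

/-- The inclusion `V ⊕ S → V ⊕ S ⊕ H` of the negatively graded part. -/
def negIncl : V × S →ₗ[ℝ] V × S × H :=
  LinearMap.prodMap LinearMap.id (LinearMap.inl ℝ S H)

end Gradings

/-! ### Lorentzian vector spaces and spinor modules -/

/-- A Lorentzian inner product: symmetric, nondegenerate, with a vector `t` such that `η(t,t) < 0`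
and `η` is positive definite on the orthogonal complement of `t`. -/
structure LorentzianForm (V : Type*) [AddCommGroup V] [Module ℝ V] where
  form : LinearMap.BilinForm ℝ V
  symm : form.IsSymm
  nondegenerate : form.Nondegenerate
  lorentzian : ∃ t, form t t < 0 ∧ ∀ v, form t v = 0 → v ≠ 0 → 0 < form v v

section Spinors

variable {V : Type*} [AddCommGroup V] [Module ℝ V] [FiniteDimensional ℝ V]

/-- The Lie algebra `𝔰𝔬(V)` of `η`-skew endomorphisms. -/
abbrev so (η : LorentzianForm V) : LieSubalgebra ℝ (Module.End ℝ V) :=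
  skewAdjointLieSubalgebra η.form

/-- The quadratic form `-η(v,v)`, giving the Clifford relation `v · v = -η(v,v) 1`. -/
def cliffordForm (η : LorentzianForm V) : QuadraticForm ℝ V :=
  -(LinearMap.BilinMap.toQuadraticMap η.form)

/-- The even subalgebra of the Clifford algebra of `(V, η)`.  It is semisimple and its simple
modules are the irreducible real spinor modules, so the (possibly extended) real spinor modules
are its finite-dimensional modules. -/
abbrev EvenClifford (η : LorentzianForm V) : Type _ :=
  CliffordAlgebra.even (cliffordForm η)

/-- The embedding `𝔰𝔬(V) → Cl₀(V)`, `A ↦ -½ ω_A`, where `ω_A ∈ ⋀² V` is given by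
`ι_{v♭} ω_A = -A v`.  In terms of a basis `eᵢ` with `η`-dual basis `eⁱ` one has
`ω_A = ½ ∑ A eᵢ ∧ eⁱ`, which is the Clifford element `½ ∑ A eᵢ · eⁱ` as `A` is traceless. -/
def spinLift (η : LorentzianForm V) : so η →ₗ[ℝ] EvenClifford η :=
  (-(1 / 4) : ℝ) • ∑ i,
    ((CliffordAlgebra.even.ι (cliffordForm η)).bilin.flip
        (η.form.dualBasis η.nondegenerate (Module.finBasis ℝ V) i)) ∘ₗ
      (LinearMap.applyₗ (Module.finBasis ℝ V i)) ∘ₗ (so η).toSubmodule.subtype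

variable (η : LorentzianForm V) (S : Type*) [AddCommGroup S] [Module ℝ S]
  [Module (EvenClifford η) S] [IsScalarTower ℝ (EvenClifford η) S]

/-- The action `A · s = -½ ω_A · s` of `𝔰𝔬(V)` on a spinor module. -/
def spinAction : so η →ₗ[ℝ] S →ₗ[ℝ] S :=
  (Algebra.lsmul ℝ ℝ S : EvenClifford η →ₐ[ℝ] Module.End ℝ S).toLinearMap ∘ₗ spinLift η

/-- A (symmetric) squaring map: an `𝔰𝔬(V)`-equivariant symmetric bilinear map `κ : S × S → V`. -/
structure SquaringMap where
  map : S →ₗ[ℝ] S →ₗ[ℝ] V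
  symm : ∀ s t, map s t = map t s
  equivariant : ∀ (A : so η) (s t : S),
    (A : Module.End ℝ V) (map s t) = map (spinAction η S A s) t + map s (spinAction η S A t)

variable {η S}

/-- `κ` is causal: for all `s ≠ 0`, the vector `κ(s,s)` is timelike or null (a null vector being
a nonzero vector with `η(v,v) = 0`). -/
def SquaringMap.IsCausal (κ : SquaringMap η S) : Prop :=
  ∀ s, s ≠ 0 → κ.map s s ≠ 0 ∧ η.form (κ.map s s) (κ.map s s) ≤ 0

/-! ### The Poincaré superalgebra `𝔰 = V ⊕ S ⊕ 𝔰𝔬(V)` -/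

variable (η S) in
/-- The underlying space of the Poincaré superalgebra. -/
abbrev Poincare : Type _ := V × S × so η

/-- The bracket of the Poincaré superalgebra: `[A,B] = AB - BA`, `[A,v] = Av`, `[A,s] = A·s`,
`[s,t] = κ(s,t)`, `[v,w] = 0`, `[v,s] = 0`. -/
def SquaringMap.bracket (κ : SquaringMap η S) :
    Poincare η S →ₗ[ℝ] Poincare η S →ₗ[ℝ] Poincare η S :=
  LinearMap.mk₂ ℝ
    (fun x y =>
      ((x.2.2 : Module.End ℝ V) y.1 - (y.2.2 : Module.End ℝ V) x.1 + κ.map x.2.1 y.2.1,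
        spinAction η S x.2.2 y.2.1 - spinAction η S y.2.2 x.2.1,
        ⁅x.2.2, y.2.2⁆))
    (by intro x x' y; ext <;> simp <;> abel)
    (by intro c x y; ext <;> simp [smul_sub])
    (by intro x y y'; ext <;> simp <;> abel)
    (by intro c x y; ext <;> simp [smul_sub])

/-- The bracket of `𝔰₋ = V ⊕ S`. -/
def SquaringMap.negBracket (κ : SquaringMap η S) : V × S →ₗ[ℝ] V × S →ₗ[ℝ] V × S :=
  LinearMap.mk₂ ℝ (fun x y => (κ.map x.2 y.2, 0))
    (by intro x x' y; simp) (by intro c x y; simp)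
    (by intro x y y'; simp) (by intro c x y; simp)

/-- The adjoint action of `𝔰₋` on `𝔰`. -/
def SquaringMap.negAct (κ : SquaringMap η S) : V × S →ₗ[ℝ] Poincare η S →ₗ[ℝ] Poincare η S :=
  κ.bracket ∘ₗ negIncl V S (so η)

/-! ### Graded subalgebras `𝔞 = V ⊕ S' ⊕ 𝔥` -/

variable (η S) in
/-- A graded subalgebra `V ⊕ S' ⊕ 𝔥` of `𝔰` containing `V`: a subspace `S' ⊆ S` and a Lie
subalgebra `𝔥 ⊆ 𝔰𝔬(V)` preserving `S'`. -/
structure GradedSubalgebra where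
  odd : Submodule ℝ S
  zero : LieSubalgebra ℝ (so η)
  stable : ∀ A ∈ zero, ∀ s ∈ odd, spinAction η S A s ∈ odd

namespace GradedSubalgebra

variable (a : GradedSubalgebra η S)

/-- `𝔞` is highly supersymmetric: `dim S' > ½ dim S`. -/
def HighlySupersymmetric : Prop :=
  Module.finrank ℝ S < 2 * Module.finrank ℝ a.odd

/-- The underlying space of `𝔞`. -/
abbrev Carrier : Type _ := V × a.odd × a.zero

/-- The underlying space `V ⊕ S'` of `𝔞₋`. -/
abbrev Neg : Type _ := V × a.odd

/-- The grading of `𝔞`. -/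
abbrev deg : ℤ → Submodule ℝ a.Carrier := grading V a.odd a.zero

/-- The inclusion `i : 𝔞 → 𝔰`. -/
def incl : a.Carrier →ₗ[ℝ] Poincare η S :=
  LinearMap.prodMap LinearMap.id (LinearMap.prodMap a.odd.subtype a.zero.toSubmodule.subtype)

/-- The inclusion `𝔞₋ → 𝔰₋`. -/
def inclNeg : a.Neg →ₗ[ℝ] V × S :=
  LinearMap.prodMap LinearMap.id a.odd.subtype

/-- The bracket of `𝔞`, the restriction of the bracket of `𝔰`. -/
def bracket (κ : SquaringMap η S) : a.Carrier →ₗ[ℝ] a.Carrier →ₗ[ℝ] a.Carrier :=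
  LinearMap.mk₂ ℝ
    (fun x y =>
      (((x.2.2 : so η) : Module.End ℝ V) y.1 - ((y.2.2 : so η) : Module.End ℝ V) x.1
          + κ.map x.2.1 y.2.1,
        ⟨spinAction η S x.2.2 y.2.1 - spinAction η S y.2.2 x.2.1,
          a.odd.sub_mem (a.stable _ x.2.2.2 _ y.2.1.2) (a.stable _ y.2.2.2 _ x.2.1.2)⟩,
        ⁅x.2.2, y.2.2⁆))
    (by intro x x' y; ext <;> simp <;> abel)
    (by intro c x y; ext <;> simp [smul_sub])
    (by intro x y y'; ext <;> simp <;> abel)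
    (by intro c x y; ext <;> simp [smul_sub])

/-- The bracket of `𝔞₋`. -/
def negBracket (κ : SquaringMap η S) : a.Neg →ₗ[ℝ] a.Neg →ₗ[ℝ] a.Neg :=
  LinearMap.mk₂ ℝ (fun x y => (κ.map x.2 y.2, 0))
    (by intro x x' y; simp) (by intro c x y; simp)
    (by intro x y y'; simp) (by intro c x y; simp)

/-- The adjoint action of `𝔞₋` on `𝔞`. -/
def negAct (κ : SquaringMap η S) : a.Neg →ₗ[ℝ] a.Carrier →ₗ[ℝ] a.Carrier :=
  a.bracket κ ∘ₗ negIncl V a.odd a.zero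

/-- The action of `𝔞₋` on `𝔰`. -/
def negActBig (κ : SquaringMap η S) : a.Neg →ₗ[ℝ] Poincare η S →ₗ[ℝ] Poincare η S :=
  κ.negAct ∘ₗ a.inclNeg

/-- `i_* : C²(𝔞₋; 𝔞) → C²(𝔞₋; 𝔰)`. -/
def push (φ : a.Neg →ₗ[ℝ] a.Neg →ₗ[ℝ] a.Carrier) : a.Neg →ₗ[ℝ] a.Neg →ₗ[ℝ] Poincare η S :=
  φ.compr₂ a.incl

/-- `i^* : C²(𝔰₋; 𝔰) → C²(𝔞₋; 𝔰)`. -/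
def pull (φ : V × S →ₗ[ℝ] V × S →ₗ[ℝ] Poincare η S) :
    a.Neg →ₗ[ℝ] a.Neg →ₗ[ℝ] Poincare η S :=
  φ.compl₁₂ a.inclNeg a.inclNeg

end GradedSubalgebra

/-! ### Normalised cocycles -/

/-- The cochain `β + γ : ⋀² 𝔰₋ → 𝔰` with components `β : V ⊗ S → S`, `γ : S ⊗ S → 𝔰𝔬(V)` and no
component `⋀² V → V`. -/
def normalisedCochain (β : V →ₗ[ℝ] S →ₗ[ℝ] S) (γ : S →ₗ[ℝ] S →ₗ[ℝ] so η) :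
    V × S →ₗ[ℝ] V × S →ₗ[ℝ] Poincare η S :=
  LinearMap.mk₂ ℝ (fun x y => (0, β x.1 y.2 - β y.1 x.2, γ x.2 y.2))
    (by intro x x' y; ext <;> simp <;> abel)
    (by intro c x y; ext <;> simp [smul_sub])
    (by intro x y y'; ext <;> simp <;> abel)
    (by intro c x y; ext <;> simp [smul_sub])

/-- `β + γ ∈ 𝓗^{2,2}`: it is a normalised Spencer `(2,2)`-cocycle of `𝔰`. -/
def IsNormalisedCocycle (κ : SquaringMap η S)
    (β : V →ₗ[ℝ] S →ₗ[ℝ] S) (γ : S →ₗ[ℝ] S →ₗ[ℝ] so η) : Prop :=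
  IsCocycle₂ (negGrading V S) (grading V S (so η)) κ.negBracket κ.negAct 2
    (normalisedCochain β γ)

/-- `A · β` for `A ∈ 𝔰𝔬(V)`. -/
def actβ (A : so η) (β : V →ₗ[ℝ] S →ₗ[ℝ] S) (v : V) (s : S) : S :=
  spinAction η S A (β v s) - β ((A : Module.End ℝ V) v) s - β v (spinAction η S A s)

/-- `A · γ` for `A ∈ 𝔰𝔬(V)`. -/
def actγ (A : so η) (γ : S →ₗ[ℝ] S →ₗ[ℝ] so η) (s t : S) : so η :=
  ⁅A, γ s t⁆ - γ (spinAction η S A s) t - γ s (spinAction η S A t)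

/-- The extension of `λ : V → 𝔰𝔬(V)` to a `(2,1)`-cochain `𝔞₋ → 𝔰`. -/
def GradedSubalgebra.lamCochain (a : GradedSubalgebra η S) (lam : V →ₗ[ℝ] so η) :
    a.Neg →ₗ[ℝ] Poincare η S :=
  LinearMap.inr ℝ V (S × so η) ∘ₗ LinearMap.inr ℝ S (so η) ∘ₗ lam ∘ₗ LinearMap.fst ℝ V a.odd

namespace GradedSubalgebra

variable (a : GradedSubalgebra η S) (κ : SquaringMap η S)

/-- `β + γ` is `𝔥`-invariant. -/
def Invariant (β : V →ₗ[ℝ] S →ₗ[ℝ] S) (γ : S →ₗ[ℝ] S →ₗ[ℝ] so η) : Prop :=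
  ∀ A ∈ a.zero, (∀ v s, actβ A β v s = 0) ∧ (∀ s t, actγ A γ s t = 0)

/-- `β + γ ∈ 𝓚^{2,2}(𝔞₋)`: `β + γ ∈ 𝓗^{2,2}` and `β` vanishes on `V ⊗ S'`. -/
def MemK (β : V →ₗ[ℝ] S →ₗ[ℝ] S) (γ : S →ₗ[ℝ] S →ₗ[ℝ] so η) : Prop :=
  IsNormalisedCocycle κ β γ ∧ ∀ v, ∀ s ∈ a.odd, β v s = 0

/-- `φ ∈ Z^{2,2}(𝔞₋; 𝔞)`. -/
def IsSpencerCocycle (φ : a.Neg →ₗ[ℝ] a.Neg →ₗ[ℝ] a.Carrier) : Prop :=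
  IsCocycle₂ (negGrading V a.odd) a.deg (a.negBracket κ) (a.negAct κ) 2 φ

/-- `φ` is an admissible cocycle: `φ ∈ Z^{2,2}(𝔞₋; 𝔞)` and `i_*[φ] = i^*[β + γ]` in
`H^{2,2}(𝔞₋; 𝔰)` for some `𝔥`-invariant `β + γ ∈ 𝓗^{2,2}`. -/
def IsAdmissible (φ : a.Neg →ₗ[ℝ] a.Neg →ₗ[ℝ] a.Carrier) : Prop :=
  a.IsSpencerCocycle κ φ ∧
    ∃ (β : V →ₗ[ℝ] S →ₗ[ℝ] S) (γ : S →ₗ[ℝ] S →ₗ[ℝ] so η),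
      IsNormalisedCocycle κ β γ ∧ a.Invariant β γ ∧
      IsCoboundary₂ (negGrading V a.odd) (grading V S (so η)) (a.negBracket κ) (a.negActBig κ) 2
        (a.push φ - a.pull (normalisedCochain β γ))

/-- `(β + γ, λ)` parametrises `φ`: `β + γ ∈ (𝓗^{2,2})^𝔥`, `λ : V → 𝔰𝔬(V)` and
`i_* φ = i^*(β + γ) + ∂λ`. -/
def IsParametrisation (φ : a.Neg →ₗ[ℝ] a.Neg →ₗ[ℝ] a.Carrier)
    (β : V →ₗ[ℝ] S →ₗ[ℝ] S) (γ : S →ₗ[ℝ] S →ₗ[ℝ] so η) (lam : V →ₗ[ℝ] so η) : Prop :=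
  IsNormalisedCocycle κ β γ ∧ a.Invariant β γ ∧
    IsDifferential₁ (negGrading V a.odd) (a.negBracket κ) (a.negActBig κ) (a.lamCochain lam)
      (a.push φ - a.pull (normalisedCochain β γ))

end GradedSubalgebra

/-! ### Integrability -/

/-- The polarisation of `Θ(v,s,s) = 2γ(s, β(v,s)) - (λ(v)·γ)(s,s)`, for fixed `v`. -/
def Theta (β : V →ₗ[ℝ] S →ₗ[ℝ] S) (γ : S →ₗ[ℝ] S →ₗ[ℝ] so η) (lam : V →ₗ[ℝ] so η) (v : V) :
    S →ₗ[ℝ] S →ₗ[ℝ] so η :=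
  LinearMap.mk₂ ℝ (fun s t => γ s (β v t) + γ t (β v s) - actγ (lam v) γ s t)
    (by intro x x' y; simp [actγ]; abel)
    (by intro c x y; simp [actγ, smul_sub])
    (by intro x y y'; simp [actγ]; abel)
    (by intro c x y; simp [actγ, smul_sub])

namespace GradedSubalgebra

open scoped TensorProduct

variable (a : GradedSubalgebra η S) (κ : SquaringMap η S)

/-- The Dirac kernel of `S'`: the kernel of `κ` on the symmetric square of `S'`, the latter
realised as the space of symmetric tensors in `S' ⊗ S'`. -/
def diracKernel : Submodule ℝ (a.odd ⊗[ℝ] a.odd) :=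
  LinearMap.eqLocus (TensorProduct.comm ℝ a.odd a.odd).toLinearMap LinearMap.id ⊓
    LinearMap.ker (TensorProduct.lift (κ.map.domRestrict₁₂ a.odd a.odd))

/-- `θ̃ : V ⊗ V → 𝔰𝔬(V)` factorises `Θ` through `κ`:
`θ̃(v, κ(s,t)) = Θ(v,s,t)` for `v ∈ V` and `s, t ∈ S'`. -/
def FactorsTheta (β : V →ₗ[ℝ] S →ₗ[ℝ] S) (γ : S →ₗ[ℝ] S →ₗ[ℝ] so η) (lam : V →ₗ[ℝ] so η)
    (θ : V →ₗ[ℝ] V →ₗ[ℝ] so η) : Prop :=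
  ∀ v, ∀ s ∈ a.odd, ∀ t ∈ a.odd, θ v (κ.map s t) = Theta β γ lam v s t

/-- `φ` is an integrable admissible cocycle: for a parametrisation `i_* φ = i^*(β + γ) + ∂λ`,
the map `Θ` annihilates the Dirac kernel, and the map `θ̃` through which it factorises satisfies
`θ̃(v,w)·s = β(v,β(w,s)) - β(w,β(v,s)) + (λ(v)·β)(w,s) - (λ(w)·β)(v,s)` for `s ∈ S'`. -/
def IsIntegrable (φ : a.Neg →ₗ[ℝ] a.Neg →ₗ[ℝ] a.Carrier) : Prop :=
  ∃ (β : V →ₗ[ℝ] S →ₗ[ℝ] S) (γ : S →ₗ[ℝ] S →ₗ[ℝ] so η) (lam : V →ₗ[ℝ] so η),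
    a.IsParametrisation κ φ β γ lam ∧
    (∀ v, ∀ ω ∈ a.diracKernel κ,
      TensorProduct.lift ((Theta β γ lam v).domRestrict₁₂ a.odd a.odd) ω = 0) ∧
    ∀ θ : V →ₗ[ℝ] V →ₗ[ℝ] so η, a.FactorsTheta κ β γ lam θ →
      ∀ v w, ∀ s ∈ a.odd,
        spinAction η S (θ v w) s =
          β v (β w s) - β w (β v s) + actβ (lam v) β w s - actβ (lam w) β v s

/-! ### The deformed bracket and realisability -/

/-- The deformed bracket, with values in `𝔰`:
`[A,B] = AB - BA`, `[A,v] = Av + [A,λ(v)] - λ(Av)`, `[A,s] = A·s`,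
`[s,t] = κ(s,t) + γ(s,t) - λ(κ(s,t))`, `[v,s] = β(v,s) + λ(v)·s`,
`[v,w] = λ(v)w - λ(w)v + θ̃(v,w) - λ(λ(v)w - λ(w)v) + [λ(v),λ(w)]`,
extended bilinearly and super-skew-symmetrically. -/
def deformedBracket (β : V →ₗ[ℝ] S →ₗ[ℝ] S) (γ : S →ₗ[ℝ] S →ₗ[ℝ] so η) (lam : V →ₗ[ℝ] so η)
    (θ : V →ₗ[ℝ] V →ₗ[ℝ] so η) : a.Carrier → a.Carrier → Poincare η S :=
  fun ⟨v, s, A⟩ ⟨w, t, B⟩ =>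
    ( ((A : so η) : Module.End ℝ V) w - ((B : so η) : Module.End ℝ V) v + κ.map s t
        + ((lam v : Module.End ℝ V) w - (lam w : Module.End ℝ V) v),
      spinAction η S A t - spinAction η S B s
        + (β v t + spinAction η S (lam v) t) - (β w s + spinAction η S (lam w) s),
      ⁅(A : so η), (B : so η)⁆
        + (⁅(A : so η), lam w⁆ - lam (((A : so η) : Module.End ℝ V) w))
        - (⁅(B : so η), lam v⁆ - lam (((B : so η) : Module.End ℝ V) v))
        + (γ s t - lam (κ.map s t))
        + (θ v w - lam ((lam v : Module.End ℝ V) w - (lam w : Module.End ℝ V) v)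
            + ⁅lam v, lam w⁆) )

/-- The bracket `b` on `𝔞` is given by the formulas of `deformedBracket` (in particular these take
values in `𝔞`). -/
def HasDeformedBracket (β : V →ₗ[ℝ] S →ₗ[ℝ] S) (γ : S →ₗ[ℝ] S →ₗ[ℝ] so η)
    (lam : V →ₗ[ℝ] so η) (θ : V →ₗ[ℝ] V →ₗ[ℝ] so η)
    (b : a.Carrier →ₗ[ℝ] a.Carrier →ₗ[ℝ] a.Carrier) : Prop :=
  ∀ x y, a.incl (b x y) = a.deformedBracket κ β γ lam θ x y

/-- `φ` is the Spencer cochain of the deformation `b`: the degree-2 part of the deformation of the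
bracket, restricted to `𝔞₋`. -/
def IsDegreeTwoPart (b : a.Carrier →ₗ[ℝ] a.Carrier →ₗ[ℝ] a.Carrier)
    (φ : a.Neg →ₗ[ℝ] a.Neg →ₗ[ℝ] a.Carrier) : Prop :=
  ∀ k l : ℤ, ∀ x ∈ negGrading V a.odd k, ∀ y ∈ negGrading V a.odd l,
    φ x y ∈ a.deg (k + l + 2) ∧
    b (negIncl V a.odd a.zero x) (negIncl V a.odd a.zero y)
      - a.bracket κ (negIncl V a.odd a.zero x) (negIncl V a.odd a.zero y)
      - φ x y ∈ filtrationOf a.deg (k + l + 3)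

/-- `b` is a geometrically realisable filtered deformation of `𝔞`: a filtered deformation whose
associated class in `H^{2,2}(𝔞₋; 𝔞)` is admissible. -/
def IsRealisableDeformation (b : a.Carrier →ₗ[ℝ] a.Carrier →ₗ[ℝ] a.Carrier) : Prop :=
  IsFilteredDeformation a.deg (a.bracket κ) b ∧
    ∃ φ, a.IsDegreeTwoPart κ b φ ∧ a.IsAdmissible κ φ

end GradedSubalgebra

end Spinors

end SpencerDeformation

end

-- Everything rests on local homogeneity (`IsCausal.span_eq_top`): if `dim S' > ½ dim S`, then `κ`
-- maps `⨀² S'` onto `V`. A vector `v ≠ 0` orthogonal to the image makes `S'` totally isotropic for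
-- `η(v, κ(-,-))`. If `v` is timelike, causality makes this form anisotropic. If `v` is spacelike,
-- the form is nondegenerate, so `S'` has at most half the dimension. If `v` is null, a half turn
-- sends it to an independent null vector, and `S'` meets its image under the spin lift only in `0`,
-- which gives the same bound. Dimension greater than two provides the plane of the half turn.
--
-- Surjectivity makes `Θ` factor uniquely through `κ`. It makes `𝔰𝔬(V)` act faithfully on `S'` in
-- the sense that an element killing `S'` is zero, so the curvature formula forces `θ̃` to be
-- alternating. It also reduces membership in `𝔥` to vectors `κ(s,t)`, where the `𝔥`-valued map `γ -
-- λκ` and the `S'`-preserving operators `β(v,-) + λ(v)` give the answer (`lie_lam_mem`,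
-- `theta_mem`).
--
-- For the Jacobi identity, the shear `A ↦ A + λ(v)` removes `λ` from the bracket formulas
-- (`zero_add_lam`, `fst_eq`, `odd_eq`). What remains is the curvature formula (two even arguments,
-- one odd), the cocycle condition with the definition of `Θ` (one even, two odd), and the cocycle
-- condition on three spinors. The purely even identity is then automatic: the even part is spanned
-- by `𝔥` and brackets of odd elements (`IsLieSuperbracket.of_odd_generated`).
--
-- An isomorphism that is even and the identity on the associated graded space can only be `(v,s,A)
-- ↦ (v,s,A + ψ(v))`. Comparing `[v,w]` and using that the first prolongation of `𝔰𝔬(V)` vanishes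
-- gives `ψ = λ - λ'`; comparing `[v,s]` then gives `β = β'` on `V ⊗ S'`. Conversely, this equality
-- forces `γ = γ'` on `S'`, so `λ - λ'` is `𝔥`-valued and defines the required shear.

attribute [local instance 100] LieRing.ofAssociativeRing

noncomputable section

namespace SpencerDeformation

open scoped TensorProduct

/-! ### The spin representation of `𝔰𝔬(V)` inside the even Clifford algebra -/

section SpinRepresentation

variable {V : Type*} [AddCommGroup V] [Module ℝ V]

namespace LorentzianForm

variable (η : LorentzianForm V)

lemma form_comm (x y : V) : η.form x y = η.form y x := η.symm.eq x y

variable {η} in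
lemma form_so_left (A : so η) (x y : V) :
    η.form ((A : Module.End ℝ V) x) y = -η.form x ((A : Module.End ℝ V) y) := by
  have h : η.form.IsSkewAdjoint (A : Module.End ℝ V) :=
    (LinearMap.mem_skewAdjointSubmodule (A : Module.End ℝ V)).mp A.2
  have h2 : η.form ((A : Module.End ℝ V) x) y = η.form x ((-(A : Module.End ℝ V)) y) := h x y
  simpa using h2

lemma mem_so_iff (A : Module.End ℝ V) :
    A ∈ so η ↔ ∀ x y, η.form (A x) y = -η.form x (A y) := by
  refine ⟨fun h => form_so_left (⟨A, h⟩ : so η), fun h => ?_⟩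
  refine (LinearMap.mem_skewAdjointSubmodule A).mpr fun x y => ?_
  simpa using h x y

/-- The skew endomorphism `x ↦ η(v,x) u - η(u,x) v`. -/
def wedge (u v : V) : so η :=
  ⟨(η.form v).smulRight u - (η.form u).smulRight v, by
    rw [mem_so_iff]
    intro x y
    simp only [LinearMap.sub_apply, LinearMap.smulRight_apply, map_sub, map_smul, smul_eq_mul,
      LinearMap.smul_apply]
    rw [η.form_comm u y, η.form_comm v y, η.form_comm x u, η.form_comm x v, η.form_comm y u,
      η.form_comm y v]
    ring⟩

@[simp]
lemma wedge_apply (u v x : V) :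
    (η.wedge u v : Module.End ℝ V) x = η.form v x • u - η.form u x • v := rfl

variable [FiniteDimensional ℝ V]

/-- The `η`-dual of the chosen basis of `V`. -/
abbrev dualFinBasis : Module.Basis (Fin (Module.finrank ℝ V)) ℝ V :=
  η.form.dualBasis η.nondegenerate (Module.finBasis ℝ V)

lemma sum_form_smul_dualFinBasis (x : V) :
    ∑ i, η.form x (Module.finBasis ℝ V i) • η.dualFinBasis i = x := by
  conv_rhs => rw [← η.dualFinBasis.sum_repr x]
  simp only [LinearMap.BilinForm.dualBasis_repr_apply]

lemma sum_form_smul_finBasis (x : V) :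
    ∑ i, η.form x (η.dualFinBasis i) • Module.finBasis ℝ V i = x := by
  have h := η.form.dualBasis_repr_apply η.nondegenerate η.dualFinBasis x
  rw [LinearMap.BilinForm.dualBasis_dualBasis η.nondegenerate η.symm] at h
  conv_rhs => rw [← (Module.finBasis ℝ V).sum_repr x]
  simp only [h]

/-- The Casimir tensor `∑ bᵢ ⊗ bⁱ` is invariant under skew endomorphisms. -/
lemma sum_apply_so_dualFinBasis {W : Type*} [AddCommGroup W] [Module ℝ W]
    (T : V →ₗ[ℝ] V →ₗ[ℝ] W) (A : so η) :
    ∑ i, T (Module.finBasis ℝ V i) ((A : Module.End ℝ V) (η.dualFinBasis i)) =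
      -∑ i, T ((A : Module.End ℝ V) (Module.finBasis ℝ V i)) (η.dualFinBasis i) := by
  have h1 : ∀ i, T (Module.finBasis ℝ V i) ((A : Module.End ℝ V) (η.dualFinBasis i)) =
      ∑ j, -(η.form ((A : Module.End ℝ V) (Module.finBasis ℝ V j)) (η.dualFinBasis i) •
        T (Module.finBasis ℝ V i) (η.dualFinBasis j)) := by
    intro i
    conv_lhs =>
      rw [← η.sum_form_smul_dualFinBasis ((A : Module.End ℝ V) (η.dualFinBasis i))]
    rw [map_sum]
    refine Finset.sum_congr rfl fun j _ => ?_
    rw [map_smul, form_so_left, η.form_comm, neg_smul]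
  have h2 : ∀ j, T ((A : Module.End ℝ V) (Module.finBasis ℝ V j)) (η.dualFinBasis j) =
      ∑ i, η.form ((A : Module.End ℝ V) (Module.finBasis ℝ V j)) (η.dualFinBasis i) •
        T (Module.finBasis ℝ V i) (η.dualFinBasis j) := by
    intro j
    conv_lhs =>
      rw [← η.sum_form_smul_finBasis ((A : Module.End ℝ V) (Module.finBasis ℝ V j))]
    rw [map_sum, LinearMap.sum_apply]
    refine Finset.sum_congr rfl fun i _ => ?_
    rw [map_smul, LinearMap.smul_apply]
  simp_rw [h1, h2, Finset.sum_neg_distrib]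
  rw [Finset.sum_comm]

end LorentzianForm

variable (η : LorentzianForm V)

open CliffordAlgebra in
lemma ι_mul_ι_swap (x y : V) :
    ι (cliffordForm η) x * ι (cliffordForm η) y =
      algebraMap ℝ _ (-2 * η.form x y) - ι (cliffordForm η) y * ι (cliffordForm η) x := by
  rw [eq_sub_iff_add_eq, ι_mul_ι_add_swap]
  congr 1
  simp only [cliffordForm, QuadraticMap.polar, neg_apply, LinearMap.BilinMap.toQuadraticMap_apply, map_add,
    LinearMap.add_apply, η.form_comm y x]
  ring

variable [FiniteDimensional ℝ V]

open CliffordAlgebra in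
lemma coe_spinLift (A : so η) :
    (spinLift η A : CliffordAlgebra (cliffordForm η)) =
      (-(1 / 4) : ℝ) • ∑ i, ι (cliffordForm η) ((A : Module.End ℝ V) (Module.finBasis ℝ V i)) *
        ι (cliffordForm η) (η.dualFinBasis i) := by
  simp only [spinLift, LinearMap.smul_apply, LinearMap.sum_apply, LinearMap.comp_apply]
  rw [Subalgebra.coe_smul, AddSubmonoidClass.coe_finsetSum]
  rfl

open CliffordAlgebra in
/-- `[spinLift A, v] = A v` in the Clifford algebra. -/
lemma spinLift_mul_ι_sub (A : so η) (v : V) :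
    (spinLift η A : CliffordAlgebra (cliffordForm η)) * ι (cliffordForm η) v -
      ι (cliffordForm η) v * spinLift η A =
      ι (cliffordForm η) ((A : Module.End ℝ V) v) := by
  -- Moving `v` through `a · b` by two anticommutations leaves only contractions.
  have h : ∀ a b : V,
      ι (cliffordForm η) a * ι (cliffordForm η) b * ι (cliffordForm η) v -
        ι (cliffordForm η) v * (ι (cliffordForm η) a * ι (cliffordForm η) b) =
      (-2 : ℝ) • ι (cliffordForm η) (η.form v b • a) +
        (2 : ℝ) • ι (cliffordForm η) (η.form v a • b) := by
    intro a b
    rw [mul_assoc, ι_mul_ι_swap η b v, mul_sub, ← mul_assoc (ι _ v), ι_mul_ι_swap η v a, sub_mul,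
      ← Algebra.commutes, ← Algebra.smul_def, ← Algebra.smul_def, mul_assoc, map_smul, map_smul,
      smul_smul, smul_smul, η.form_comm b v]
    rw [neg_mul, neg_mul, neg_smul, neg_smul]
    abel
  rw [coe_spinLift, smul_mul_assoc, mul_smul_comm, ← smul_sub, Finset.sum_mul, Finset.mul_sum,
    ← Finset.sum_sub_distrib]
  simp_rw [h]
  rw [Finset.sum_add_distrib, ← Finset.smul_sum, ← Finset.smul_sum, ← map_sum, ← map_sum]
  have h1 : ∑ i, η.form v (η.dualFinBasis i) • (A : Module.End ℝ V) (Module.finBasis ℝ V i) =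
      (A : Module.End ℝ V) v := by
    conv_rhs => rw [← η.sum_form_smul_finBasis v]
    simp only [map_sum, map_smul]
  have h2 : ∑ i, η.form v ((A : Module.End ℝ V) (Module.finBasis ℝ V i)) • η.dualFinBasis i =
      -(A : Module.End ℝ V) v := by
    conv_rhs => rw [← η.sum_form_smul_dualFinBasis ((A : Module.End ℝ V) v)]
    rw [← Finset.sum_neg_distrib]
    refine Finset.sum_congr rfl fun i _ => ?_
    rw [LorentzianForm.form_so_left, neg_smul, neg_neg]
  rw [h1, h2, map_neg, smul_neg, ← sub_eq_add_neg, ← sub_smul, smul_smul]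
  norm_num

open CliffordAlgebra in
-- Commutation with the lift of `A` is the derivation extending `A`. Applied to `∑ B bᵢ · bⁱ`, it
-- hits both factors; invariance of the Casimir tensor moves the second contribution onto the first
-- factor, which produces `AB - BA`.
lemma spinLift_lie (A B : so η) :
    spinLift η ⁅A, B⁆ = spinLift η A * spinLift η B - spinLift η B * spinLift η A := by
  apply Subtype.ext
  rw [Subalgebra.coe_sub, Subalgebra.coe_mul, Subalgebra.coe_mul]
  -- The lift of `A` stays opaque: only those of `⁅A, B⁆` and `B` are to be expanded in the basis.
  obtain ⟨E, hE⟩ : ∃ E : CliffordAlgebra (cliffordForm η), E = spinLift η A := ⟨_, rfl⟩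
  have hc : ∀ x, E * ι (cliffordForm η) x = ι (cliffordForm η) ((A : Module.End ℝ V) x) +
      ι (cliffordForm η) x * E := fun x => by
    rw [← spinLift_mul_ι_sub, hE]; abel
  have hterm : ∀ a b : V, E * (ι (cliffordForm η) a * ι (cliffordForm η) b) -
      ι (cliffordForm η) a * ι (cliffordForm η) b * E =
      ι (cliffordForm η) ((A : Module.End ℝ V) a) * ι (cliffordForm η) b +
        ι (cliffordForm η) a * ι (cliffordForm η) ((A : Module.End ℝ V) b) := by
    intro a b
    rw [← mul_assoc, hc, add_mul, mul_assoc _ E, hc, mul_add, mul_assoc]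
    abel
  rw [← hE, coe_spinLift, coe_spinLift η B, mul_smul_comm, smul_mul_assoc, ← smul_sub, Finset.mul_sum,
    Finset.sum_mul, ← Finset.sum_sub_distrib]
  simp_rw [hterm]
  congr 1
  rw [Finset.sum_add_distrib]
  have h := η.sum_apply_so_dualFinBasis
    (((LinearMap.mul ℝ (CliffordAlgebra (cliffordForm η))).compl₁₂ (ι (cliffordForm η))
      (ι (cliffordForm η))) ∘ₗ (B : Module.End ℝ V)) A
  simp only [LinearMap.comp_apply, LinearMap.compl₁₂_apply, LinearMap.mul_apply'] at h
  rw [h, ← sub_eq_add_neg, ← Finset.sum_sub_distrib]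
  refine Finset.sum_congr rfl fun i _ => ?_
  rw [← sub_mul, ← map_sub]
  rfl

open CliffordAlgebra in
/-- The infinitesimal rotation in the plane of two orthonormal vectors squares to `-1/4`. -/
lemma spinLift_wedge_mul_self {e f : V} (he : η.form e e = 1) (hf : η.form f f = 1)
    (hef : η.form e f = 0) :
    spinLift η (η.wedge e f) * spinLift η (η.wedge e f) = algebraMap ℝ _ (-(1 / 4) : ℝ) := by
  have hfe : ι (cliffordForm η) f * ι (cliffordForm η) e =
      -(ι (cliffordForm η) e * ι (cliffordForm η) f) := by
    rw [ι_mul_ι_swap, η.form_comm, hef]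
    simp
  have hsq : ∀ x, η.form x x = 1 → ι (cliffordForm η) x * ι (cliffordForm η) x = -1 := by
    intro x hx
    rw [ι_sq_scalar, show cliffordForm η x = -1 from congrArg Neg.neg hx, map_neg, map_one]
  have hsum : ∀ u v : V,
      ∑ i, ι (cliffordForm η) (η.form u (Module.finBasis ℝ V i) • v) *
        ι (cliffordForm η) (η.dualFinBasis i) =
      ι (cliffordForm η) v * ι (cliffordForm η) u := by
    intro u v
    conv_rhs => rw [← η.sum_form_smul_dualFinBasis u, map_sum, Finset.mul_sum]
    refine Finset.sum_congr rfl fun i _ => ?_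
    rw [map_smul, map_smul, smul_mul_assoc, mul_smul_comm]
  -- The basis sum collapses to `e·f - f·e = 2 e·f`, so the factor `-1/4` becomes `-1/2`.
  have hE : (spinLift η (η.wedge e f) : CliffordAlgebra (cliffordForm η)) =
      (-(1 / 2) : ℝ) • (ι (cliffordForm η) e * ι (cliffordForm η) f) := by
    rw [coe_spinLift]
    simp only [LorentzianForm.wedge_apply, map_sub, sub_mul, Finset.sum_sub_distrib]
    rw [hsum, hsum, hfe, sub_neg_eq_add, ← two_smul ℝ, smul_smul]
    norm_num
  have hprod : ι (cliffordForm η) e * ι (cliffordForm η) f *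
      (ι (cliffordForm η) e * ι (cliffordForm η) f) = -1 := by
    rw [mul_assoc, ← mul_assoc (ι _ f), hfe, neg_mul, mul_assoc, hsq f hf, mul_neg_one, neg_neg,
      hsq e he]
  apply Subtype.ext
  rw [Subalgebra.coe_mul, hE, smul_mul_smul_comm, hprod, Subalgebra.coe_algebraMap,
    Algebra.algebraMap_eq_smul_one, smul_neg, ← neg_smul]
  norm_num

variable {η} {S : Type*} [AddCommGroup S] [Module ℝ S]
  [Module (EvenClifford η) S] [IsScalarTower ℝ (EvenClifford η) S]

lemma spinAction_apply (A : so η) (s : S) : spinAction η S A s = spinLift η A • s := rfl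

lemma spinAction_lie (A B : so η) (s : S) :
    spinAction η S ⁅A, B⁆ s =
      spinAction η S A (spinAction η S B s) - spinAction η S B (spinAction η S A s) := by
  simp only [spinAction_apply, spinLift_lie, sub_smul, mul_smul]

lemma spinAction_wedge_sq {e f : V} (he : η.form e e = 1) (hf : η.form f f = 1)
    (hef : η.form e f = 0) (s : S) :
    spinAction η S (η.wedge e f) (spinAction η S (η.wedge e f) s) = (-(1 / 4) : ℝ) • s := by
  rw [spinAction_apply, spinAction_apply, smul_smul, spinLift_wedge_mul_self η he hf hef,
    algebraMap_smul]

end SpinRepresentation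

/-! ### Lorentzian geometry and local homogeneity -/

section Homogeneity

variable {V : Type*} [AddCommGroup V] [Module ℝ V]

namespace LorentzianForm

variable (η : LorentzianForm V)

/-- The orthogonal complement of a timelike vector is positive definite. -/
lemma form_pos_of_orthogonal_timelike {v w : V} (hv : η.form v v < 0) (hvw : η.form v w = 0)
    (hw : w ≠ 0) : 0 < η.form w w := by
  obtain ⟨t, -, ht⟩ := η.lorentzian
  by_contra! hneg
  have htv : η.form t v ≠ 0 := by
    intro h
    have hv0 : v ≠ 0 := by rintro rfl; simp at hv
    exact absurd (ht v h hv0) (not_lt.mpr hv.le)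
  -- This combination of `v` and `w` is orthogonal to `t`. Its square is nonpositive if `η(w,w) ≤
  -- 0`, so it must vanish.
  set x := η.form t w • v - η.form t v • w with hx
  have htx : η.form t x = 0 := by
    simp only [hx, map_sub, map_smul, smul_eq_mul]; ring
  have hxx : η.form x x = η.form t w ^ 2 * η.form v v + η.form t v ^ 2 * η.form w w := by
    simp only [hx, map_sub, map_smul, LinearMap.sub_apply, LinearMap.smul_apply, smul_eq_mul,
      hvw, η.form_comm w v]
    ring
  have hx0 : x = 0 := by
    by_contra h
    have := ht x htx h
    nlinarith [sq_nonneg (η.form t w), sq_nonneg (η.form t v)]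
  have h := congrArg (fun y => η.form y v) hx0
  simp only [hx, map_sub, map_smul, LinearMap.sub_apply, LinearMap.smul_apply, smul_eq_mul,
    η.form_comm w v, hvw, mul_zero, sub_zero, map_zero, LinearMap.zero_apply] at h
  have htw : η.form t w = 0 := by
    rcases mul_eq_zero.mp h with h | h
    · exact h
    · exact absurd h hv.ne
  rw [hx, htw, zero_smul, zero_sub, neg_eq_zero] at hx0
  exact (smul_ne_zero htv hw) hx0

/-- In dimension at least three there is a unit spacelike vector orthogonal to two given vectors,
the first of which is timelike. -/
lemma exists_unit_orthogonal (hV : 2 < Module.finrank ℝ V) {τ : V} (hτ : η.form τ τ < 0) (e : V) :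
    ∃ f, η.form f f = 1 ∧ η.form τ f = 0 ∧ η.form e f = 0 := by
  obtain ⟨f, hf, hf0⟩ : ∃ f ∈ LinearMap.ker ((η.form τ).prod (η.form e)), f ≠ 0 := by
    refine (Submodule.ne_bot_iff _).mp fun h => ?_
    have := LinearMap.finrank_le_finrank_of_injective (LinearMap.ker_eq_bot.mp h)
    rw [Module.finrank_prod, Module.finrank_self] at this
    omega
  have hτf : η.form τ f = 0 := congrArg Prod.fst (LinearMap.mem_ker.mp hf)
  have hef : η.form e f = 0 := congrArg Prod.snd (LinearMap.mem_ker.mp hf)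
  have hpos := η.form_pos_of_orthogonal_timelike hτ hτf hf0
  refine ⟨(Real.sqrt (η.form f f))⁻¹ • f, ?_, by simp [hτf], by simp [hef]⟩
  simp only [map_smul, LinearMap.smul_apply, smul_eq_mul]
  rw [← mul_assoc, ← mul_inv, Real.mul_self_sqrt hpos.le, inv_mul_cancel₀ hpos.ne']

end LorentzianForm

variable [FiniteDimensional ℝ V] {η : LorentzianForm V}
variable {S : Type*} [AddCommGroup S] [Module ℝ S]
  [Module (EvenClifford η) S] [IsScalarTower ℝ (EvenClifford η) S]

namespace SquaringMap

variable (κ : SquaringMap η S)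

/-- The symmetric bilinear form `(s,t) ↦ η(v, κ(s,t))`. -/
def pairing (v : V) : LinearMap.BilinForm ℝ S := κ.map.compr₂ (η.form v)

@[simp]
lemma pairing_apply (v : V) (s t : S) : κ.pairing v s t = η.form v (κ.map s t) := rfl

variable {κ}

/-- The complement of a timelike vector is positive definite, so it contains no nonzero causal
vector. Thus pairing `κ` with a timelike vector gives an anisotropic form. -/
lemma IsCausal.eq_zero_of_orthogonal_timelike (hκ : κ.IsCausal) {τ : V} (hτ : η.form τ τ < 0)
    {s : S} (h : η.form τ (κ.map s s) = 0) : s = 0 := by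
  by_contra hs
  obtain ⟨h0, hle⟩ := hκ s hs
  exact absurd (η.form_pos_of_orthogonal_timelike hτ h h0) (not_lt.mpr hle)

/-- For spacelike `v` the pairing `η(v, κ(s,t))` is nondegenerate. -/
lemma IsCausal.pairing_nondegenerate_of_spacelike (hκ : κ.IsCausal) {v : V}
    (hv : 0 < η.form v v) : (κ.pairing v).Nondegenerate := by
  obtain ⟨t, ht, -⟩ := η.lorentzian
  -- Removing the spacelike component along `v` only lowers the square, so `τ` is still timelike.
  set τ := t - (η.form t v / η.form v v) • v with hτ_def
  have hvτ : η.form v τ = 0 := by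
    simp only [hτ_def, map_sub, map_smul, smul_eq_mul, η.form_comm v t]
    field_simp
    ring
  have hττ : η.form τ τ < 0 := by
    have h : η.form τ τ = η.form t t - η.form t v ^ 2 / η.form v v := by
      have h1 : η.form τ τ = η.form t τ := by
        calc η.form τ τ = η.form t τ - η.form t v / η.form v v * η.form v τ := by
              conv_lhs => rw [η.form_comm, hτ_def]
              rw [← hτ_def, η.form_comm t τ, η.form_comm v τ, map_sub, map_smul, smul_eq_mul]
          _ = η.form t τ := by rw [hvτ, mul_zero, sub_zero]
      rw [h1, hτ_def, map_sub, map_smul, smul_eq_mul]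
      ring
    rw [h]
    have := div_nonneg (sq_nonneg (η.form t v)) hv.le
    linarith
  have hsymm : (κ.pairing v).IsRefl := fun s t h => by
    rw [pairing_apply, κ.symm]; exact h
  refine (LinearMap.IsRefl.nondegenerate_iff_separatingLeft hsymm).mpr fun s hs => ?_
  refine hκ.eq_zero_of_orthogonal_timelike hττ ?_
  -- A radical vector `s` is tested against its image under the boost in the plane of `τ` and `v`.
  -- Equivariance turns this into `η(v,v) η(τ, κ(s,s)) = 0`.
  have h1 := hs (spinAction η S (η.wedge τ v) s)
  have h2 := κ.equivariant (η.wedge τ v) s s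
  have h3 := congrArg (η.form v) h2
  rw [pairing_apply] at h1
  rw [κ.symm (spinAction η S _ s) s, map_add, h1, LorentzianForm.wedge_apply, map_sub, map_smul,
    map_smul, hvτ] at h3
  simp only [smul_eq_mul, mul_zero, zero_sub, add_zero, neg_eq_zero, mul_eq_zero, hv.ne',
    or_false] at h3
  exact h3

variable [FiniteDimensional ℝ S]

/-- A subspace that is isotropic for `η(v, κ(-,-))`, `v` null, has at most half the dimension. -/
lemma IsCausal.two_mul_finrank_le_of_null (hV : 2 < Module.finrank ℝ V) (hκ : κ.IsCausal) {v : V}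
    (hv : v ≠ 0) (hvv : η.form v v = 0) (W : Submodule ℝ S)
    (hW : ∀ s ∈ W, η.form v (κ.map s s) = 0) :
    2 * Module.finrank ℝ W ≤ Module.finrank ℝ S := by
  obtain ⟨t, htt, ht⟩ := η.lorentzian
  have htv : η.form t v ≠ 0 := fun h =>
    absurd (ht v h hv) (by rw [hvv]; exact lt_irrefl 0)
  -- normalise so that `v` is proportional to `τ + e`, with `τ`, `e` orthogonal and `e` unit
  set r := Real.sqrt (-η.form t t) with hr
  have hr0 : 0 < r := Real.sqrt_pos.mpr (by linarith)
  have hrr : r * r = -η.form t t := Real.mul_self_sqrt (by linarith)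
  set τ := r⁻¹ • t with hτ
  have hττ : η.form τ τ = -1 := by
    simp only [hτ, map_smul, LinearMap.smul_apply, smul_eq_mul]
    rw [← mul_assoc, ← mul_inv, hrr]
    field_simp [htt.ne]
  have hτv : η.form τ v ≠ 0 := by
    simp only [hτ, map_smul, LinearMap.smul_apply, smul_eq_mul]
    exact mul_ne_zero (inv_ne_zero hr0.ne') htv
  set a := -η.form τ v with ha
  have ha0 : a ≠ 0 := neg_ne_zero.mpr hτv
  set e := a⁻¹ • v - τ with he_def
  have hτe : η.form τ e = 0 := by
    simp only [he_def, map_sub, map_smul, smul_eq_mul, hττ]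
    rw [show η.form τ v = -a by rw [ha, neg_neg]]
    field_simp
    ring
  have hv_eq : v = a • (τ + e) := by
    rw [he_def, add_sub_cancel, smul_smul, mul_inv_cancel₀ ha0, one_smul]
  have hee : η.form e e = 1 := by
    have h1 : η.form (τ + e) (τ + e) = 0 := by
      have := hvv
      rw [hv_eq] at this
      simp only [map_smul, LinearMap.smul_apply, smul_eq_mul, mul_eq_zero, ha0, false_or] at this
      exact this
    simp only [map_add, LinearMap.add_apply, hττ, hτe, η.form_comm e τ] at h1
    linarith
  obtain ⟨f, hff, hτf, hef⟩ := η.exists_unit_orthogonal hV (by rw [hττ]; norm_num : _ < (0 : ℝ)) e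
  set R := η.wedge e f with hR
  set σ := spinAction η S R with hσ
  have hσσ : ∀ s, σ (σ s) = (-(1 / 4) : ℝ) • s := spinAction_wedge_sq hee hff hef
  -- rotation by `π` in the plane of `e` and `f`
  have hrot : ∀ s u, η.form (τ - e) (κ.map (σ s) (σ u)) =
      (1 / 4) * η.form (τ + e) (κ.map s u) := by
    intro s u
    -- Two uses of equivariance and `σ² = -1/4` give `κ(σs,σu) = ½(R² + ½) κ(s,u)`. As `R²` is `-1`
    -- on the plane of `e`, `f` and `0` on its complement, this is one quarter of the half turn of
    -- `κ(s,u)`.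
    have h2 := congrArg (R : Module.End ℝ V) (κ.equivariant R s u)
    rw [← hσ, map_add, κ.equivariant R (σ s) u, κ.equivariant R s (σ u), ← hσ, hσσ, hσσ] at h2
    have h3 := congrArg (η.form (τ - e)) h2
    simp only [hR, LorentzianForm.wedge_apply, map_add, map_sub, map_smul, LinearMap.sub_apply,
      LinearMap.smul_apply, smul_eq_mul, hee, hff, hef, hτe, hτf, η.form_comm f e] at h3
    simp only [map_add, map_sub, LinearMap.sub_apply, LinearMap.add_apply]
    linarith
  have hσinj : Function.Injective σ := fun s u h => by
    have := congrArg σ h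
    rw [hσσ, hσσ] at this
    exact smul_right_injective S (by norm_num : (-(1 / 4) : ℝ) ≠ 0) this
  have hnull : ∀ s ∈ W, η.form (τ + e) (κ.map s s) = 0 := by
    intro s hs
    have := hW s hs
    rw [hv_eq, map_smul, LinearMap.smul_apply, smul_eq_mul, mul_eq_zero] at this
    exact this.resolve_left ha0
  -- For `s` in the intersection, `κ(s,s)` is orthogonal to both `τ + e` and `τ - e`, hence to the
  -- timelike `τ`.
  have hdisj : Disjoint W (W.map σ) := by
    rw [Submodule.disjoint_def]
    rintro _ hs ⟨u, hu, rfl⟩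
    refine hκ.eq_zero_of_orthogonal_timelike (by rw [hττ]; norm_num : η.form τ τ < 0) ?_
    have h1 := hnull _ hs
    have h2 := hrot u u
    rw [hnull u hu] at h2
    simp only [map_add, map_sub, LinearMap.sub_apply, LinearMap.add_apply] at h1 h2
    linarith
  have h1 := Submodule.finrank_add_finrank_le_of_disjoint hdisj
  rw [(Submodule.equivMapOfInjective σ hσinj W).symm.finrank_eq] at h1
  omega

/-- **Local homogeneity**: on a subspace of more than half the dimension, a causal squaring map
spans `V`. -/
theorem IsCausal.span_eq_top (hV : 2 < Module.finrank ℝ V) (hκ : κ.IsCausal) (W : Submodule ℝ S)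
    (hW : Module.finrank ℝ S < 2 * Module.finrank ℝ W) :
    LinearMap.range (TensorProduct.lift (κ.map.domRestrict₁₂ W W)) = ⊤ := by
  by_contra hne
  obtain ⟨l, hl0, hl⟩ := Submodule.exists_le_ker_of_lt_top _ (lt_top_iff_ne_top.mpr hne)
  obtain ⟨v, rfl⟩ := (LinearMap.BilinForm.toDual η.form η.nondegenerate).surjective l
  have hv : v ≠ 0 := by rintro rfl; simp at hl0
  have horth : ∀ s ∈ W, ∀ t ∈ W, η.form v (κ.map s t) = 0 := by
    intro s hs t ht
    have := hl (LinearMap.mem_range_self _ ((⟨s, hs⟩ : W) ⊗ₜ[ℝ] (⟨t, ht⟩ : W)))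
    simpa [LinearMap.BilinForm.toDual_def, LinearMap.domRestrict₁₂_apply] using this
  rcases lt_trichotomy (η.form v v) 0 with h | h | h
  · obtain ⟨s, hs, hs0⟩ : ∃ s ∈ W, s ≠ 0 := by
      refine (Submodule.ne_bot_iff W).mp ?_
      rintro rfl
      simp at hW
    exact hs0 (hκ.eq_zero_of_orthogonal_timelike h (horth s hs s hs))
  · have := hκ.two_mul_finrank_le_of_null hV hv h W fun s hs => horth s hs s hs
    omega
  -- For a nondegenerate form, the inclusion `W ≤ W^⊥` bounds `dim W` by half of `dim S`.
  · have hrefl : (κ.pairing v).IsRefl := fun s t h => by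
      rw [pairing_apply, κ.symm]; exact h
    have h1 := LinearMap.BilinForm.finrank_orthogonal
      (hκ.pairing_nondegenerate_of_spacelike h) W
    have h2 : W ≤ (κ.pairing v).orthogonal W := fun t ht s hs => horth s hs t ht
    have h3 := Submodule.finrank_mono h2
    have h4 := Submodule.finrank_le W
    omega

end SquaringMap

end Homogeneity

/-! ### Filtration and parity in components -/

section Gradings

variable {V S H : Type*} [AddCommGroup V] [Module ℝ V] [AddCommGroup S] [Module ℝ S]
  [AddCommGroup H] [Module ℝ H]

lemma mem_grading {k : ℤ} {x : V × S × H} :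
    x ∈ grading V S H k ↔
      (k ≠ -2 → x.1 = 0) ∧ (k ≠ -1 → x.2.1 = 0) ∧ (k ≠ 0 → x.2.2 = 0) := Iff.rfl

lemma mem_negGrading {k : ℤ} {x : V × S} :
    x ∈ negGrading V S k ↔ (k ≠ -2 → x.1 = 0) ∧ (k ≠ -1 → x.2 = 0) := Iff.rfl

lemma left_mem_grading (v : V) : ((v, 0, 0) : V × S × H) ∈ grading V S H (-2) := by
  simp [mem_grading]

lemma middle_mem_grading (s : S) : ((0, s, 0) : V × S × H) ∈ grading V S H (-1) := by
  simp [mem_grading]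

lemma right_mem_grading (A : H) : ((0, 0, A) : V × S × H) ∈ grading V S H 0 := by
  simp [mem_grading]

lemma left_mem_negGrading (v : V) : ((v, 0) : V × S) ∈ negGrading V S (-2) := by
  simp [mem_negGrading]

lemma right_mem_negGrading (s : S) : ((0, s) : V × S) ∈ negGrading V S (-1) := by
  simp [mem_negGrading]

omit [Module ℝ V] [Module ℝ S] [Module ℝ H] in
lemma prod_eq_add (x : V × S × H) : x = (x.1, 0, 0) + (0, x.2.1, 0) + (0, 0, x.2.2) := by
  ext <;> simp

/-- With only the degrees `-2`, `-1`, `0` occupied, filtration statements become three vanishing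
conditions governed by integer inequalities. -/
lemma mem_filtrationOf_grading {k : ℤ} {x : V × S × H} :
    x ∈ filtrationOf (grading V S H) k ↔
      (-2 < k → x.1 = 0) ∧ (-1 < k → x.2.1 = 0) ∧ (0 < k → x.2.2 = 0) := by
  constructor
  · let F : Submodule ℝ (V × S × H) :=
      { carrier := {x | (-2 < k → x.1 = 0) ∧ (-1 < k → x.2.1 = 0) ∧ (0 < k → x.2.2 = 0)}
        zero_mem' := by simp
        add_mem' := by
          rintro x y ⟨h1, h2, h3⟩ ⟨h1', h2', h3'⟩
          exact ⟨fun h => by simp [h1 h, h1' h], fun h => by simp [h2 h, h2' h],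
            fun h => by simp [h3 h, h3' h]⟩
        smul_mem' := by
          rintro c x ⟨h1, h2, h3⟩
          exact ⟨fun h => by simp [h1 h], fun h => by simp [h2 h], fun h => by simp [h3 h]⟩ }
    have hF : filtrationOf (grading V S H) k ≤ F :=
      iSup₂_le fun l hl y hy =>
        ⟨fun h => hy.1 (by omega), fun h => hy.2.1 (by omega), fun h => hy.2.2 (by omega)⟩
    exact fun hx => hF hx
  · rintro ⟨h1, h2, h3⟩
    have hmem : ∀ l : ℤ, ∀ y ∈ grading V S H l, (¬ k ≤ l → y = 0) →
        y ∈ filtrationOf (grading V S H) k := by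
      intro l y hy h
      by_cases hl : k ≤ l
      · exact (le_iSup₂_of_le (f := fun (l : ℤ) (_ : k ≤ l) => grading V S H l) l hl le_rfl) hy
      · rw [h hl]; exact zero_mem _
    rw [prod_eq_add x]
    refine add_mem (add_mem ?_ ?_) ?_
    · exact hmem (-2) _ (left_mem_grading _) fun h => by rw [h1 (by omega)]; rfl
    · exact hmem (-1) _ (middle_mem_grading _) fun h => by rw [h2 (by omega)]; rfl
    · exact hmem 0 _ (right_mem_grading _) fun h => by rw [h3 (by omega)]; rfl

lemma grading_le_parityPart (k : ℤ) {ε : ZMod 2} (h : (k : ZMod 2) = ε) :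
    grading V S H k ≤ parityPart (grading V S H) ε :=
  le_iSup₂_of_le (f := fun (l : ℤ) (_ : (l : ZMod 2) = ε) => grading V S H l) k h le_rfl

lemma intCast_neg_two : ((-2 : ℤ) : ZMod 2) = 0 := rfl

lemma intCast_neg_one : ((-1 : ℤ) : ZMod 2) = 1 := rfl

lemma two_eq_zero : (2 : ZMod 2) = 0 := rfl

lemma mem_parityPart_zero {x : V × S × H} :
    x ∈ parityPart (grading V S H) 0 ↔ x.2.1 = 0 := by
  constructor
  · have h : parityPart (grading V S H) 0 ≤
        LinearMap.ker (LinearMap.fst ℝ S H ∘ₗ LinearMap.snd ℝ V (S × H)) :=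
      iSup₂_le fun l hl y hy => hy.2.1 (by rintro rfl; revert hl; decide)
    exact fun hx => h hx
  · intro hx
    have h0 : x = (x.1, 0, 0) + (0, 0, x.2.2) := by ext <;> simp [hx]
    rw [h0]
    exact add_mem (grading_le_parityPart (-2) intCast_neg_two (left_mem_grading _))
      (grading_le_parityPart 0 Int.cast_zero (right_mem_grading _))

lemma mem_parityPart_one {x : V × S × H} :
    x ∈ parityPart (grading V S H) 1 ↔ x.1 = 0 ∧ x.2.2 = 0 := by
  constructor
  · have h : parityPart (grading V S H) 1 ≤
        LinearMap.ker (LinearMap.fst ℝ V (S × H)) ⊓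
          LinearMap.ker (LinearMap.snd ℝ S H ∘ₗ LinearMap.snd ℝ V (S × H)) :=
      iSup₂_le fun l hl y hy =>
        ⟨hy.1 (by rintro rfl; revert hl; decide), hy.2.2 (by rintro rfl; revert hl; decide)⟩
    exact fun hx => h hx
  · rintro ⟨h1, h2⟩
    have h0 : x = (0, x.2.1, 0) := by ext <;> simp [h1, h2]
    rw [h0]
    exact grading_le_parityPart (-1) intCast_neg_one (middle_mem_grading _)

end Gradings

@[simp] lemma superSign_zero_left (j : ZMod 2) : superSign 0 j = 1 := by simp [superSign]

@[simp] lemma superSign_zero_right (i : ZMod 2) : superSign i 0 = 1 := by simp [superSign]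

@[simp] lemma superSign_one_one : superSign 1 1 = -1 := by simp [superSign]

/-! ### Components of the cocycle and parametrisation equations -/

section CocycleConditions

variable {V : Type*} [AddCommGroup V] [Module ℝ V] [FiniteDimensional ℝ V] {η : LorentzianForm V}
variable {S : Type*} [AddCommGroup S] [Module ℝ S]
  [Module (EvenClifford η) S] [IsScalarTower ℝ (EvenClifford η) S]
variable {κ : SquaringMap η S} {β β' : V →ₗ[ℝ] S →ₗ[ℝ] S} {γ γ' : S →ₗ[ℝ] S →ₗ[ℝ] so η}
  {lam lam' : V →ₗ[ℝ] so η}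

namespace IsNormalisedCocycle

lemma symm (h : IsNormalisedCocycle κ β γ) (s t : S) : γ s t = γ t s := by
  have h1 := (h.1 (-1) (-1) _ (right_mem_negGrading s) _ (right_mem_negGrading t)).2
  have h2 := congrArg (fun x => x.2.2) h1
  simpa [normalisedCochain, intCast_neg_one] using h2

/-- This is the cocycle condition on one vector and two spinors. It shows that `γ` is determined by
`β`. -/
lemma apply_vector (h : IsNormalisedCocycle κ β γ) (v : V) (s t : S) :
    (γ s t : Module.End ℝ V) v = -(κ.map s (β v t) + κ.map (β v s) t) := by
  have h1 := h.2 (-2) (-1) (-1) _ (left_mem_negGrading v) _ (right_mem_negGrading s) _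
    (right_mem_negGrading t)
  have h2 := congrArg (fun x => x.1) h1
  simp [normalisedCochain, SquaringMap.negAct, SquaringMap.bracket, SquaringMap.negBracket,
    negIncl, two_eq_zero] at h2
  rw [κ.symm (β v s) t]
  linear_combination (norm := module) (-1 : ℝ) • h2

/-- This is the cocycle condition on three spinors, later the Jacobi identity for three odd
elements. -/
lemma apply_spinor (h : IsNormalisedCocycle κ β γ) (s t u : S) :
    spinAction η S (γ t u) s + spinAction η S (γ u s) t + spinAction η S (γ s t) u =
      -(β (κ.map s t) u + β (κ.map t u) s + β (κ.map u s) t) := by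
  have h1 := h.2 (-1) (-1) (-1) _ (right_mem_negGrading s) _ (right_mem_negGrading t) _
    (right_mem_negGrading u)
  have h2 := congrArg (fun x => x.2.1) h1
  simp [normalisedCochain, SquaringMap.negAct, SquaringMap.bracket, SquaringMap.negBracket,
    negIncl] at h2
  rw [show (1 + 1 : ZMod 2) = 0 from rfl, superSign_zero_left, superSign_zero_right, one_smul,
    one_smul] at h2
  linear_combination (norm := module) (-1 : ℝ) • h2

lemma sub (h : IsNormalisedCocycle κ β γ) (h' : IsNormalisedCocycle κ β' γ') :
    IsNormalisedCocycle κ (β' - β) (γ' - γ) := by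
  have hsub : normalisedCochain (β' - β) (γ' - γ) =
      normalisedCochain β' γ' - normalisedCochain β γ := by
    ext x y <;> (simp [normalisedCochain]; try abel)
  rw [IsNormalisedCocycle, hsub]
  refine ⟨fun k l x hx y hy => ⟨?_, ?_⟩, fun k l m x hx y hy z hz => ?_⟩
  · exact sub_mem (h'.1 k l x hx y hy).1 (h.1 k l x hx y hy).1
  · rw [LinearMap.sub_apply, LinearMap.sub_apply, (h'.1 k l x hx y hy).2, (h.1 k l x hx y hy).2]
    simp only [LinearMap.sub_apply, smul_sub]
    abel
  · have e1 := h.2 k l m x hx y hy z hz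
    have e2 := h'.2 k l m x hx y hy z hz
    rw [← sub_eq_zero.mpr (e2.trans e1.symm)]
    simp only [LinearMap.sub_apply, map_sub, smul_sub]
    abel

end IsNormalisedCocycle

namespace GradedSubalgebra

variable {a : GradedSubalgebra η S} {φ : a.Neg →ₗ[ℝ] a.Neg →ₗ[ℝ] a.Carrier}

namespace IsParametrisation

/-- A normalised cochain has no `⋀² V → V` component, so this part of the cocycle comes from `∂λ`
alone. It is what allows `λ` to be recovered from `φ`. -/
lemma incl_vector_vector (h : a.IsParametrisation κ φ β γ lam) (v w : V) :
    a.incl (φ (v, 0) (w, 0)) =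
      ((lam v : Module.End ℝ V) w - (lam w : Module.End ℝ V) v, 0, 0) := by
  have h1 := h.2.2 (-2) (-2) _ (left_mem_negGrading v) _ (left_mem_negGrading w)
  rw [LinearMap.sub_apply, LinearMap.sub_apply, sub_eq_iff_eq_add] at h1
  refine Eq.trans h1 ?_
  simp [normalisedCochain, negActBig, SquaringMap.negAct, SquaringMap.bracket, negBracket,
    negIncl, two_eq_zero, lamCochain, pull, inclNeg]
  abel

lemma incl_vector_spinor (h : a.IsParametrisation κ φ β γ lam) (v : V) (s : a.odd) :
    a.incl (φ (v, 0) (0, s)) = (0, β v s + spinAction η S (lam v) s, 0) := by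
  have h1 := h.2.2 (-2) (-1) _ (left_mem_negGrading v) _ (right_mem_negGrading s)
  rw [LinearMap.sub_apply, LinearMap.sub_apply, sub_eq_iff_eq_add] at h1
  refine Eq.trans h1 ?_
  simp [normalisedCochain, negActBig, SquaringMap.negAct, SquaringMap.bracket, negBracket,
    negIncl, two_eq_zero, lamCochain, pull, inclNeg]
  abel

lemma incl_spinor_spinor (h : a.IsParametrisation κ φ β γ lam) (s t : a.odd) :
    a.incl (φ (0, s) (0, t)) = (0, 0, γ s t - lam (κ.map s t)) := by
  have h1 := h.2.2 (-1) (-1) _ (right_mem_negGrading s) _ (right_mem_negGrading t)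
  rw [LinearMap.sub_apply, LinearMap.sub_apply, sub_eq_iff_eq_add] at h1
  refine Eq.trans h1 ?_
  simp [normalisedCochain, negActBig, SquaringMap.negAct, SquaringMap.bracket, negBracket,
    negIncl, lamCochain, pull, inclNeg]
  abel

end IsParametrisation

end GradedSubalgebra

end CocycleConditions

/-! ### Factorisation of `Θ`, values in `𝔥`, and independence of the parametrisation -/

section Integrability

variable {V : Type*} [AddCommGroup V] [Module ℝ V] {η : LorentzianForm V}

lemma so_add_apply (A B : so η) (v : V) :
    ((A + B : so η) : Module.End ℝ V) v =
      (A : Module.End ℝ V) v + (B : Module.End ℝ V) v := rfl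

lemma so_sub_apply (A B : so η) (v : V) :
    ((A - B : so η) : Module.End ℝ V) v =
      (A : Module.End ℝ V) v - (B : Module.End ℝ V) v := rfl

lemma so_smul_apply (c : ℝ) (A : so η) (v : V) :
    ((c • A : so η) : Module.End ℝ V) v = c • (A : Module.End ℝ V) v := rfl

/-- The first prolongation of `𝔰𝔬(V)` is trivial. -/
lemma eq_zero_of_symmetric_so {μ : V →ₗ[ℝ] so η}
    (h : ∀ v w, (μ v : Module.End ℝ V) w = (μ w : Module.End ℝ V) v) : μ = 0 := by
  have hskew : ∀ x y z, η.form ((μ x : Module.End ℝ V) y) z =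
      -η.form ((μ x : Module.End ℝ V) z) y := fun x y z => by
    rw [LorentzianForm.form_so_left, η.form_comm]
  refine LinearMap.ext fun x => Subtype.ext (LinearMap.ext fun y => ?_)
  refine η.nondegenerate.1 _ fun z => ?_
  -- The trilinear form is skew in the last two slots and symmetric in the first two. Alternating
  -- these swaps three times each returns to the start with sign `-1`.
  have h1 : η.form ((μ x : Module.End ℝ V) y) z = -η.form ((μ x : Module.End ℝ V) y) z := by
    conv_lhs => rw [hskew, h x z, hskew, neg_neg, h z y, hskew, h y x]
  linarith

variable [FiniteDimensional ℝ V]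
variable {S : Type*} [AddCommGroup S] [Module ℝ S]
  [Module (EvenClifford η) S] [IsScalarTower ℝ (EvenClifford η) S]
variable {κ : SquaringMap η S} {β β' : V →ₗ[ℝ] S →ₗ[ℝ] S} {γ γ' : S →ₗ[ℝ] S →ₗ[ℝ] so η}
  {lam lam' : V →ₗ[ℝ] so η} {θ θ' : V →ₗ[ℝ] V →ₗ[ℝ] so η}

namespace GradedSubalgebra

variable (a : GradedSubalgebra η S)

/-- `κ` maps `⨀² S'` onto `V`. -/
def Spans (κ : SquaringMap η S) : Prop :=
  LinearMap.range (TensorProduct.lift (κ.map.domRestrict₁₂ a.odd a.odd)) = ⊤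

variable {a}

lemma Spans.induction (hsp : a.Spans κ) {P : V → Prop} (zero : P 0)
    (add : ∀ v w, P v → P w → P (v + w)) (base : ∀ s ∈ a.odd, ∀ t ∈ a.odd, P (κ.map s t))
    (v : V) : P v := by
  obtain ⟨ω, rfl⟩ := LinearMap.range_eq_top.mp hsp v
  induction ω using TensorProduct.induction_on with
  | zero => rw [map_zero]; exact zero
  | tmul s t => exact base s s.2 t t.2
  | add x y hx hy => rw [map_add]; exact add _ _ hx hy

/-- By equivariance, killing `S'` implies killing every `κ(s,t)`, and these span `V`. -/
lemma Spans.eq_zero_of_annihilates (hsp : a.Spans κ) {A : so η}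
    (h : ∀ s ∈ a.odd, spinAction η S A s = 0) : A = 0 := by
  refine Subtype.ext (LinearMap.ext fun v => ?_)
  refine hsp.induction (P := fun v => (A : Module.End ℝ V) v = 0) (map_zero _)
    (fun v w hv hw => by rw [map_add, hv, hw, add_zero]) (fun s hs t ht => ?_) v
  rw [κ.equivariant, h s hs, h t ht, map_zero, map_zero, LinearMap.zero_apply, add_zero]

/-- The properties of a parametrisation `(β + γ, λ)` that are used in the construction of the
deformed bracket. -/
structure IsCompatible (a : GradedSubalgebra η S) (κ : SquaringMap η S)
    (β : V →ₗ[ℝ] S →ₗ[ℝ] S) (γ : S →ₗ[ℝ] S →ₗ[ℝ] so η) (lam : V →ₗ[ℝ] so η) : Prop where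
  cocycle : IsNormalisedCocycle κ β γ
  invariant : a.Invariant β γ
  stable : ∀ v, ∀ s ∈ a.odd, β v s + spinAction η S (lam v) s ∈ a.odd
  mem_zero : ∀ s ∈ a.odd, ∀ t ∈ a.odd, γ s t - lam (κ.map s t) ∈ a.zero

/-- The two membership properties hold because these expressions are components of `φ`, which is
`𝔞`-valued. -/
lemma IsParametrisation.isCompatible {φ : a.Neg →ₗ[ℝ] a.Neg →ₗ[ℝ] a.Carrier}
    (h : a.IsParametrisation κ φ β γ lam) : a.IsCompatible κ β γ lam where
  cocycle := h.1
  invariant := h.2.1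
  stable v s hs := by
    have h1 : ((φ (v, 0) (0, ⟨s, hs⟩)).2.1 : S) = β v s + spinAction η S (lam v) s :=
      congrArg (fun x => x.2.1) (h.incl_vector_spinor v ⟨s, hs⟩)
    exact h1 ▸ (φ (v, 0) (0, ⟨s, hs⟩)).2.1.2
  mem_zero s hs t ht := by
    have h1 : ((φ (0, ⟨s, hs⟩) (0, ⟨t, ht⟩)).2.2 : so η) = γ s t - lam (κ.map s t) :=
      congrArg (fun x => x.2.2) (h.incl_spinor_spinor ⟨s, hs⟩ ⟨t, ht⟩)
    exact h1 ▸ (φ (0, ⟨s, hs⟩) (0, ⟨t, ht⟩)).2.2.2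

/-- A parametrisation is determined by the cocycle up to the values of `β`, `γ` outside `S'`. -/
lemma IsParametrisation.unique {φ : a.Neg →ₗ[ℝ] a.Neg →ₗ[ℝ] a.Carrier}
    (h : a.IsParametrisation κ φ β γ lam) (h' : a.IsParametrisation κ φ β' γ' lam') :
    lam = lam' ∧ (∀ v, ∀ s ∈ a.odd, β v s = β' v s) ∧
      ∀ s ∈ a.odd, ∀ t ∈ a.odd, γ s t = γ' s t := by
  have hlam : lam = lam' := by
    -- The cocycle fixes the skew-symmetrisation of `λ`, so the difference of two choices is
    -- symmetric and lies in the first prolongation.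
    refine sub_eq_zero.mp (eq_zero_of_symmetric_so fun v w => ?_)
    have h1 := congrArg (fun x => x.1) ((h.incl_vector_vector v w).symm.trans
      (h'.incl_vector_vector v w))
    change (lam v : Module.End ℝ V) w - (lam' v : Module.End ℝ V) w =
      (lam w : Module.End ℝ V) v - (lam' w : Module.End ℝ V) v
    exact sub_eq_sub_iff_sub_eq_sub.mp h1
  subst hlam
  refine ⟨rfl, fun v s hs => ?_, fun s hs t ht => ?_⟩
  · exact add_right_cancel (congrArg (fun x => x.2.1)
      ((h.incl_vector_spinor v ⟨s, hs⟩).symm.trans (h'.incl_vector_spinor v ⟨s, hs⟩)))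
  · exact sub_left_injective (congrArg (fun x => x.2.2)
      ((h.incl_spinor_spinor ⟨s, hs⟩ ⟨t, ht⟩).symm.trans (h'.incl_spinor_spinor ⟨s, hs⟩ ⟨t, ht⟩)))

end GradedSubalgebra

lemma Theta_apply (v : V) (s t : S) :
    Theta β γ lam v s t = γ s (β v t + spinAction η S (lam v) t) +
      γ t (β v s) + γ (spinAction η S (lam v) s) t - ⁅lam v, γ s t⁆ := by
  simp only [Theta, LinearMap.mk₂_apply, actγ, map_add]
  abel

/-- Grouping `β(v,s) + λ(v)·s`, which stays in `S'`, shows that `Θ` on `S'` needs `β` and `γ` only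
on `S'`. -/
lemma Theta_apply_of_symm (hγ : ∀ s t, γ s t = γ t s) (v : V) (s t : S) :
    Theta β γ lam v s t = γ (β v s + spinAction η S (lam v) s) t +
      γ s (β v t + spinAction η S (lam v) t) - ⁅lam v, γ s t⁆ := by
  rw [Theta_apply, hγ t, map_add, map_add, LinearMap.add_apply]
  abel

lemma Theta_symm (hγ : ∀ s t, γ s t = γ t s) (v : V) (s t : S) :
    Theta β γ lam v s t = Theta β γ lam v t s := by
  rw [Theta_apply_of_symm hγ, Theta_apply_of_symm hγ, hγ _ t, hγ s (_ + _), hγ s t]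
  abel

/-- In this form `β` is evaluated only on `s` and on the combinations `β(v,s) + λ(v)·s`. For `s ∈
S'`, the curvature expression therefore depends only on `β` restricted to `V ⊗ S'`. -/
lemma sub_actβ (v w : V) (s : S) :
    β v (β w s) - β w (β v s) + actβ (lam v) β w s - actβ (lam w) β v s =
      spinAction η S (lam v) (β w s) + β v (β w s + spinAction η S (lam w) s) -
        (spinAction η S (lam w) (β v s) + β w (β v s + spinAction η S (lam v) s)) +
        β ((lam w : Module.End ℝ V) v - (lam v : Module.End ℝ V) w) s := by
  simp only [actβ, map_add, map_sub, LinearMap.sub_apply]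
  abel

namespace GradedSubalgebra

variable {a : GradedSubalgebra η S}

namespace IsCompatible

variable (h : a.IsCompatible κ β γ lam)
include h

lemma symm (s t : S) : γ s t = γ t s := h.cocycle.symm s t

lemma lie_γ {A : so η} (hA : A ∈ a.zero) (s t : S) :
    ⁅A, γ s t⁆ = γ (spinAction η S A s) t + γ s (spinAction η S A t) := by
  have := (h.invariant A hA).2 s t
  rwa [actγ, sub_sub, sub_eq_zero] at this

/-- On `v = κ(s,t)`, invariance of `γ` and equivariance of `κ` identify this, up to sign, with the
failure of the `𝔥`-valued map `γ - λκ` to be `A`-invariant. -/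
lemma lie_lam_mem (hsp : a.Spans κ) {A : so η} (hA : A ∈ a.zero) (v : V) :
    ⁅A, lam v⁆ - lam ((A : Module.End ℝ V) v) ∈ a.zero := by
  refine hsp.induction (P := fun v => ⁅A, lam v⁆ - lam ((A : Module.End ℝ V) v) ∈ a.zero)
    (by simp) (fun v w hv hw => ?_) (fun s hs t ht => ?_) v
  · convert add_mem hv hw using 1
    rw [map_add, map_add, map_add, lie_add]
    abel
  · have h1 := a.zero.lie_mem hA (h.mem_zero s hs t ht)
    have h2 := h.mem_zero _ (a.stable A hA s hs) t ht
    have h3 := h.mem_zero s hs _ (a.stable A hA t ht)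
    convert sub_mem (add_mem h2 h3) h1 using 1
    rw [lie_sub, h.lie_γ hA, κ.equivariant, map_add]
    abel

/-- Take `w = κ(s,t)`, `δ = β(v,-) + λ(v)` and `A = γ(s,t) - λ(κ(s,t))`. The expression is then `(γ
- λκ)(δs,t) + (γ - λκ)(s,δt) + [A,λ(v)] - λ(Av)`, each term of which is in `𝔥`. -/
lemma theta_mem (hsp : a.Spans κ) (hθ : a.FactorsTheta κ β γ lam θ) (v w : V) :
    θ v w - lam ((lam v : Module.End ℝ V) w - (lam w : Module.End ℝ V) v) + ⁅lam v, lam w⁆ ∈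
      a.zero := by
  refine hsp.induction (P := fun w =>
    θ v w - lam ((lam v : Module.End ℝ V) w - (lam w : Module.End ℝ V) v) + ⁅lam v, lam w⁆ ∈
      a.zero) (by simp) (fun w₁ w₂ h₁ h₂ => ?_) (fun s hs t ht => ?_) w
  · convert add_mem h₁ h₂ using 1
    simp only [map_add, map_sub, lie_add, so_add_apply]
    abel
  · have h1 := h.mem_zero _ (h.stable v s hs) t ht
    have h2 := h.mem_zero s hs _ (h.stable v t ht)
    have h3 := h.lie_lam_mem hsp (h.mem_zero s hs t ht) v
    have h4 : κ.map (β v s + spinAction η S (lam v) s) t +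
        κ.map s (β v t + spinAction η S (lam v) t) =
        (lam v : Module.End ℝ V) (κ.map s t) - (γ s t : Module.End ℝ V) v := by
      rw [κ.equivariant, h.cocycle.apply_vector]
      simp only [map_add, LinearMap.add_apply]
      abel
    convert add_mem (add_mem h1 h2) h3 using 1
    rw [hθ v s hs t ht, Theta_apply_of_symm h.symm]
    have h5 : lam (κ.map (β v s + spinAction η S (lam v) s) t) +
        lam (κ.map s (β v t + spinAction η S (lam v) t)) =
        lam ((lam v : Module.End ℝ V) (κ.map s t)) - lam ((γ s t : Module.End ℝ V) v) := by
      rw [← map_add, h4, map_sub]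
    rw [sub_add_sub_comm, h5, sub_lie, ← lie_skew (lam v), ← lie_skew (lam v), so_sub_apply,
      map_sub, map_sub]
    abel

lemma exists_factorsTheta (hsp : a.Spans κ)
    (hker : ∀ v, ∀ ω ∈ a.diracKernel κ,
      TensorProduct.lift ((Theta β γ lam v).domRestrict₁₂ a.odd a.odd) ω = 0) :
    ∃ θ : V →ₗ[ℝ] V →ₗ[ℝ] so η, a.FactorsTheta κ β γ lam θ := by
  set K := TensorProduct.lift (κ.map.domRestrict₁₂ a.odd a.odd) with hK
  set T := fun v => TensorProduct.lift ((Theta β γ lam v).domRestrict₁₂ a.odd a.odd) with hT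
  -- A linear section of `κ` defines `θ(v,w)` as `Θ(v, σ(w))`. The choice does not matter once
  -- `Θ(v,-)` kills the whole kernel of `κ` on `S' ⊗ S'`.
  obtain ⟨σ, hσ⟩ := K.exists_rightInverse_of_surjective hsp
  have hKc : ∀ ω, K (TensorProduct.comm ℝ a.odd a.odd ω) = K ω := by
    intro ω
    induction ω using TensorProduct.induction_on with
    | zero => simp
    | tmul s t => exact κ.symm t s
    | add x y hx hy => rw [map_add, map_add, hx, hy, map_add]
  have hTc : ∀ v ω, T v (TensorProduct.comm ℝ a.odd a.odd ω) = T v ω := by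
    intro v ω
    induction ω using TensorProduct.induction_on with
    | zero => simp
    | tmul s t => exact Theta_symm h.symm v t s
    | add x y hx hy => rw [map_add, map_add, hx, hy, map_add]
  have hcc : ∀ ω, TensorProduct.comm ℝ a.odd a.odd (TensorProduct.comm ℝ a.odd a.odd ω) = ω :=
    (TensorProduct.comm ℝ a.odd a.odd).symm_apply_apply
  -- The hypothesis covers only symmetric tensors. Since `K` and `T v` are swap-invariant, it
  -- applies to the symmetrisation of `ω`, on which `T v` takes the value `2 T v ω`.
  have hTker : ∀ v ω, K ω = 0 → T v ω = 0 := by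
    intro v ω hω
    have h1 : ω + TensorProduct.comm ℝ a.odd a.odd ω ∈ a.diracKernel κ := by
      refine ⟨?_, ?_⟩
      · change TensorProduct.comm ℝ a.odd a.odd _ = _
        rw [map_add, hcc, add_comm]
        rfl
      · change K _ = 0
        rw [map_add, hKc, hω, add_zero]
    have h2 : T v (ω + TensorProduct.comm ℝ a.odd a.odd ω) = 0 := hker v _ h1
    rw [map_add, hTc, ← two_smul ℝ, smul_eq_zero] at h2
    exact h2.resolve_left two_ne_zero
  have hTadd : ∀ v w ω, T (v + w) ω = T v ω + T w ω := by
    intro v w ω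
    induction ω using TensorProduct.induction_on with
    | zero => simp
    | tmul s t =>
      simp only [hT, TensorProduct.lift.tmul, LinearMap.domRestrict₁₂_apply, Theta_apply, map_add,
        LinearMap.add_apply, add_lie]
      abel
    | add x y hx hy => rw [map_add, hx, hy, map_add, map_add]; abel
  have hTsmul : ∀ (c : ℝ) v ω, T (c • v) ω = c • T v ω := by
    intro c v ω
    induction ω using TensorProduct.induction_on with
    | zero => simp
    | tmul s t =>
      simp only [hT, TensorProduct.lift.tmul, LinearMap.domRestrict₁₂_apply, Theta_apply, map_add,
        map_smul, LinearMap.smul_apply, smul_lie, smul_add, smul_sub]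
    | add x y hx hy => rw [map_add, hx, hy, map_add, smul_add]
  refine ⟨LinearMap.mk₂ ℝ (fun v w => T v (σ w)) (fun _ _ _ => hTadd _ _ _)
    (fun _ _ _ => hTsmul _ _ _) (fun _ _ _ => by rw [map_add, map_add])
    (fun _ _ _ => by rw [map_smul, map_smul]), fun v s hs t ht => ?_⟩
  have h1 : K (σ (κ.map s t) - (⟨s, hs⟩ : a.odd) ⊗ₜ[ℝ] (⟨t, ht⟩ : a.odd)) = 0 := by
    rw [map_sub, sub_eq_zero]
    exact LinearMap.congr_fun hσ (κ.map s t)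
  have h2 := hTker v _ h1
  rw [map_sub, sub_eq_zero] at h2
  exact h2

omit h in
lemma _root_.SpencerDeformation.GradedSubalgebra.FactorsTheta.unique (hsp : a.Spans κ)
    (hθ : a.FactorsTheta κ β γ lam θ) (hθ' : a.FactorsTheta κ β γ lam θ') : θ = θ' := by
  refine LinearMap.ext fun v => LinearMap.ext fun w => ?_
  refine hsp.induction (P := fun w => θ v w = θ' v w) (by simp)
    (fun w₁ w₂ h₁ h₂ => by rw [map_add, map_add, h₁, h₂])
    (fun s hs t ht => by rw [hθ v s hs t ht, hθ' v s hs t ht]) w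

end IsCompatible

/-- Integrability of `φ` does not depend on the parametrisation. -/
lemma IsIntegrable.of_isParametrisation {φ : a.Neg →ₗ[ℝ] a.Neg →ₗ[ℝ] a.Carrier}
    (hφ : a.IsIntegrable κ φ) (h : a.IsParametrisation κ φ β γ lam) :
    (∀ v, ∀ ω ∈ a.diracKernel κ,
      TensorProduct.lift ((Theta β γ lam v).domRestrict₁₂ a.odd a.odd) ω = 0) ∧
    ∀ θ : V →ₗ[ℝ] V →ₗ[ℝ] so η, a.FactorsTheta κ β γ lam θ →
      ∀ v w, ∀ s ∈ a.odd, spinAction η S (θ v w) s =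
        β v (β w s) - β w (β v s) + actβ (lam v) β w s - actβ (lam w) β v s := by
  obtain ⟨β₀, γ₀, lam₀, h₀, hker, hcurv⟩ := hφ
  obtain ⟨rfl, hβ, hγ⟩ := h₀.unique h
  have hst := h₀.isCompatible.stable
  have hTheta : ∀ v, ∀ s ∈ a.odd, ∀ t ∈ a.odd,
      Theta β₀ γ₀ lam₀ v s t = Theta β γ lam₀ v s t := by
    intro v s hs t ht
    rw [Theta_apply_of_symm h₀.isCompatible.symm, Theta_apply_of_symm h.isCompatible.symm,
      hγ _ (hst v s hs) t ht, hγ s hs _ (hst v t ht), hγ s hs t ht, hβ v s hs, hβ v t ht]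
  refine ⟨fun v ω hω => ?_, fun θ hθ v w s hs => ?_⟩
  · rw [← hker v ω hω]
    congr 2
    refine LinearMap.ext fun s => LinearMap.ext fun t => ?_
    exact (hTheta v s s.2 t t.2).symm
  · rw [hcurv θ (fun v s hs t ht => by rw [hTheta v s hs t ht]; exact hθ v s hs t ht) v w s hs,
      sub_actβ, sub_actβ, hβ _ _ (hst w s hs), hβ _ _ (hst v s hs), hβ v s hs, hβ w s hs,
      hβ _ s hs]

/-- The factorisation of `Θ` is alternating when it has the curvature form required by
integrability. -/
lemma FactorsTheta.alternating (hsp : a.Spans κ)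
    (hcurv : ∀ v w, ∀ s ∈ a.odd, spinAction η S (θ v w) s =
      β v (β w s) - β w (β v s) + actβ (lam v) β w s - actβ (lam w) β v s) (v : V) :
    θ v v = 0 :=
  -- The curvature expression vanishes identically on the diagonal.
  hsp.eq_zero_of_annihilates fun s hs => by rw [hcurv v v s hs]; abel

end GradedSubalgebra

end Integrability

/-! ### Reducing the Jacobi identity to odd arguments -/

section SuperJacobi

variable {L : Type*} [AddCommGroup L] [Module ℝ L]

/-- A superbracket for which the Jacobi identity holds whenever one of the arguments is odd is a
Lie superbracket as soon as the even part is generated, modulo a subspace on which the Jacobi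
identity holds, by brackets of odd elements. -/
lemma IsLieSuperbracket.of_odd_generated {𝒢 : ZMod 2 → Submodule ℝ L} {b : L →ₗ[ℝ] L →ₗ[ℝ] L}
    (mem : ∀ i j, ∀ x ∈ 𝒢 i, ∀ y ∈ 𝒢 j, b x y ∈ 𝒢 (i + j))
    (skew₀ : ∀ x ∈ 𝒢 0, ∀ i, ∀ y ∈ 𝒢 i, b x y = -b y x)
    (symm₁ : ∀ x ∈ 𝒢 1, ∀ y ∈ 𝒢 1, b x y = b y x)
    (jac₁ : ∀ x ∈ 𝒢 0, ∀ y ∈ 𝒢 0, ∀ z ∈ 𝒢 1, b x (b y z) = b (b x y) z + b y (b x z))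
    (jac₂ : ∀ x ∈ 𝒢 0, ∀ y ∈ 𝒢 1, ∀ z ∈ 𝒢 1, b x (b y z) = b (b x y) z + b y (b x z))
    (jac₃ : ∀ x ∈ 𝒢 1, ∀ y ∈ 𝒢 1, ∀ z ∈ 𝒢 1,
      b (b x y) z + b (b y z) x + b (b z x) y = 0)
    (H : Submodule ℝ L) (hH : H ≤ 𝒢 0)
    (jacH : ∀ x ∈ H, ∀ y ∈ H, ∀ z ∈ H, b x (b y z) = b (b x y) z + b y (b x z))
    (gen : ∀ x ∈ 𝒢 0, ∃ h ∈ H,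
      x - h ∈ Submodule.span ℝ {u | ∃ s ∈ 𝒢 1, ∃ t ∈ 𝒢 1, u = b s t}) :
    IsLieSuperbracket 𝒢 b := by
  have m00 : ∀ {x y}, x ∈ 𝒢 0 → y ∈ 𝒢 0 → b x y ∈ 𝒢 0 := fun hx hy => mem 0 0 _ hx _ hy
  have m01 : ∀ {x y}, x ∈ 𝒢 0 → y ∈ 𝒢 1 → b x y ∈ 𝒢 1 := fun hx hy => mem 0 1 _ hx _ hy
  have m10 : ∀ {x y}, x ∈ 𝒢 1 → y ∈ 𝒢 0 → b x y ∈ 𝒢 1 := fun hx hy => mem 1 0 _ hx _ hy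
  have m11 : ∀ {x y}, x ∈ 𝒢 1 → y ∈ 𝒢 1 → b x y ∈ 𝒢 0 := fun hx hy => mem 1 1 _ hx _ hy
  have swap : ∀ {x y i}, x ∈ 𝒢 i → y ∈ 𝒢 0 → b x y = -b y x := fun hx hy => by
    rw [skew₀ _ hy _ _ hx, neg_neg]
  let J : L → L → L →ₗ[ℝ] L := fun x y => b x ∘ₗ b y - b (b x y) - b y ∘ₗ b x
  have hJ : ∀ x y z, J x y z = b x (b y z) - b (b x y) z - b y (b x z) := fun _ _ _ => rfl
  -- For even `x`, `y` the Jacobiator acts as a derivation on brackets of odd elements, by `jac₂`,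
  -- and kills the odd elements themselves, by `jac₁`.
  have hJodd : ∀ x ∈ 𝒢 0, ∀ y ∈ 𝒢 0,
      ∀ u ∈ Submodule.span ℝ {u | ∃ s ∈ 𝒢 1, ∃ t ∈ 𝒢 1, u = b s t}, J x y u = 0 := by
    intro x hx y hy u hu
    induction hu using Submodule.span_induction with
    | mem u hu =>
      obtain ⟨s, hs, t, ht, rfl⟩ := hu
      rw [hJ, jac₂ y hy s hs t ht, jac₂ x hx s hs t ht, jac₂ _ (m00 hx hy) s hs t ht, map_add,
        map_add, jac₂ x hx _ (m01 hy hs) t ht, jac₂ x hx s hs _ (m01 hy ht),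
        jac₂ y hy _ (m01 hx hs) t ht, jac₂ y hy s hs _ (m01 hx ht),
        jac₁ x hx y hy s hs, jac₁ x hx y hy t ht]
      simp only [map_add, LinearMap.add_apply]
      abel
    | zero => rw [map_zero]
    | add u w _ _ hu hw => rw [map_add, hu, hw, add_zero]
    | smul c u _ hu => rw [map_smul, hu, smul_zero]
  have hJswap : ∀ x ∈ 𝒢 0, ∀ y ∈ 𝒢 0, ∀ z ∈ 𝒢 0, J x y z = -J x z y := by
    intro x hx y hy z hz
    rw [hJ, hJ, swap hy hz, swap (m00 hx hy) hz, swap (m00 hx hz) hy, map_neg]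
    abel
  have hJswap' : ∀ x ∈ 𝒢 0, ∀ y ∈ 𝒢 0, ∀ z ∈ 𝒢 0, J x y z = -J y x z := by
    intro x hx y hy z hz
    rw [hJ, hJ, swap hx hy, map_neg, LinearMap.neg_apply]
    abel
  have hJred : ∀ x ∈ 𝒢 0, ∀ y ∈ 𝒢 0, ∀ z ∈ 𝒢 0, ∃ h ∈ H, J x y z = J x y h := by
    intro x hx y hy z hz
    obtain ⟨h, hh, hu⟩ := gen z hz
    refine ⟨h, hh, ?_⟩
    have := hJodd x hx y hy _ hu
    rwa [map_sub, sub_eq_zero] at this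
  have jac₀ : ∀ x ∈ 𝒢 0, ∀ y ∈ 𝒢 0, ∀ z ∈ 𝒢 0, b x (b y z) = b (b x y) z + b y (b x z) := by
    intro x hx y hy z hz
    rw [← sub_eq_zero, ← sub_sub, ← hJ]
    -- The Jacobiator alternates on even elements, so each argument can be moved to the last slot
    -- and replaced there by an element of `H`.
    obtain ⟨h₃, hh₃, e₃⟩ := hJred x hx y hy z hz
    obtain ⟨h₂, hh₂, e₂⟩ := hJred x hx h₃ (hH hh₃) y hy
    obtain ⟨h₁, hh₁, e₁⟩ := hJred h₃ (hH hh₃) h₂ (hH hh₂) x hx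
    rw [e₃, hJswap x hx y hy _ (hH hh₃), e₂, hJswap' x hx _ (hH hh₃) _ (hH hh₂),
      hJswap _ (hH hh₃) x hx _ (hH hh₂), e₁, hJ, jacH _ hh₃ _ hh₂ _ hh₁]
    simp
  have cases : ∀ i : ZMod 2, i = 0 ∨ i = 1 := by decide
  refine ⟨mem, ?_, ?_⟩
  · intro i j x hx y hy
    rcases cases i with rfl | rfl
    · simpa using skew₀ x hx j y hy
    · rcases cases j with rfl | rfl
      · simpa using swap hx hy
      · simpa using symm₁ x hx y hy
  · intro i j k x hx y hy z hz
    rcases cases i with rfl | rfl <;> rcases cases j with rfl | rfl <;>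
      rcases cases k with rfl | rfl <;>
      simp only [superSign_zero_left, superSign_zero_right, superSign_one_one, one_smul,
        Units.neg_smul]
    · exact jac₀ x hx y hy z hz
    · exact jac₁ x hx y hy z hz
    · rw [swap hy hz, map_neg, jac₁ x hx z hz y hy, swap (m01 hx hy) hz, swap hy (m00 hx hz)]
      abel
    · exact jac₂ x hx y hy z hz
    · rw [swap hx (m00 hy hz), swap hx hy, map_neg, LinearMap.neg_apply, swap (m01 hy hx) hz,
        swap hx hz, map_neg, jac₁ y hy z hz x hx]
      abel
    · rw [swap hx hy, map_neg, LinearMap.neg_apply, jac₂ y hy x hx z hz]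
      abel
    · rw [swap hy hz, swap (m11 hx hy) hz, swap hx hz, map_neg, map_neg, jac₂ z hz x hx y hy,
        symm₁ _ (m01 hz hx) y hy]
      abel
    · have h := jac₃ x hx y hy z hz
      rw [swap hx (m11 hy hz), swap hy (m11 hx hz), symm₁ x hx z hz, neg_neg]
      rw [← sub_eq_zero, ← neg_eq_zero, ← h]
      abel

end SuperJacobi


/-! ### The deformed bracket and its Jacobi identities -/

section DeformedBracket

variable {V : Type*} [AddCommGroup V] [Module ℝ V] [FiniteDimensional ℝ V] {η : LorentzianForm V}
variable {S : Type*} [AddCommGroup S] [Module ℝ S]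
  [Module (EvenClifford η) S] [IsScalarTower ℝ (EvenClifford η) S]

local instance : AddCommMonoid (so η) := inferInstance
local instance : AddCommGroup (so η) := inferInstance
variable {κ : SquaringMap η S} {β β' : V →ₗ[ℝ] S →ₗ[ℝ] S} {γ γ' : S →ₗ[ℝ] S →ₗ[ℝ] so η}
  {lam lam' : V →ₗ[ℝ] so η} {θ θ' : V →ₗ[ℝ] V →ₗ[ℝ] so η}

namespace GradedSubalgebra

variable {a : GradedSubalgebra η S}
local instance : AddCommMonoid a.Carrier := inferInstance
local instance : AddCommGroup a.Carrier := inferInstance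
local instance : AddCommMonoid a.zero := inferInstance
local instance : AddCommGroup a.zero := inferInstance
local instance : AddMonoid a.zero := inferInstance
local instance : AddMonoid (so η) := inferInstance
variable {b : a.Carrier →ₗ[ℝ] a.Carrier →ₗ[ℝ] a.Carrier}

lemma incl_injective : Function.Injective a.incl := by
  intro x y h
  exact Prod.ext (congrArg (fun x => x.1) h) (Prod.ext (Subtype.ext (congrArg (fun x => x.2.1) h))
    (Subtype.ext (congrArg (fun x => x.2.2) h)))

lemma coe_zero_add (A B : a.zero) : ((A + B : a.zero) : so η) = A + B := rfl

lemma coe_zero_neg (A : a.zero) : ((-A : a.zero) : so η) = -A := rfl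

lemma coe_zero_smul (c : ℝ) (A : a.zero) : ((c • A : a.zero) : so η) = c • (A : so η) := rfl

lemma exists_hasDeformedBracket (hsp : a.Spans κ) (h : a.IsCompatible κ β γ lam)
    (hθ : a.FactorsTheta κ β γ lam θ) : ∃ b, a.HasDeformedBracket κ β γ lam θ b := by
  have hex : ∀ x y, ∃ z, a.incl z = a.deformedBracket κ β γ lam θ x y := by
    rintro ⟨v, s, A⟩ ⟨w, t, B⟩
    refine ⟨(_, ⟨_, ?_⟩, ⟨_, ?_⟩), rfl⟩
    · exact sub_mem (add_mem (sub_mem (a.stable _ A.2 _ t.2) (a.stable _ B.2 _ s.2))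
        (h.stable v t t.2)) (h.stable w s s.2)
    · exact add_mem (add_mem (sub_mem (add_mem (a.zero.lie_mem A.2 B.2)
        (h.lie_lam_mem hsp A.2 w)) (h.lie_lam_mem hsp B.2 v)) (h.mem_zero s s.2 t t.2))
        (h.theta_mem hsp hθ v w)
  choose f hf using hex
  refine ⟨LinearMap.mk₂ ℝ f (fun x x' y => ?_) (fun c x y => ?_) (fun x y y' => ?_)
    (fun c x y => ?_), fun x y => hf x y⟩ <;> apply incl_injective
  · rw [map_add, hf, hf, hf]
    refine Prod.ext ?_ (Prod.ext ?_ ?_) <;>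
    · simp only [deformedBracket, Prod.fst_add, Prod.snd_add, Submodule.coe_add, map_add, map_sub,
        coe_zero_add, LinearMap.add_apply, so_add_apply, add_lie, lie_add]
      abel
  · rw [map_smul, hf, hf]
    refine Prod.ext ?_ (Prod.ext ?_ ?_) <;>
    · simp only [deformedBracket, Prod.smul_fst, Prod.smul_snd, Submodule.coe_smul, map_smul,
        map_sub, coe_zero_smul, LinearMap.smul_apply, so_smul_apply, smul_lie, lie_smul, smul_add,
        smul_sub]
  · rw [map_add, hf, hf, hf]
    refine Prod.ext ?_ (Prod.ext ?_ ?_) <;>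
    · simp only [deformedBracket, Prod.fst_add, Prod.snd_add, Submodule.coe_add, map_add, map_sub,
        coe_zero_add, LinearMap.add_apply, so_add_apply, add_lie, lie_add]
      abel
  · rw [map_smul, hf, hf]
    refine Prod.ext ?_ (Prod.ext ?_ ?_) <;>
    · simp only [deformedBracket, Prod.smul_fst, Prod.smul_snd, Submodule.coe_smul, map_smul,
        map_sub, coe_zero_smul, LinearMap.smul_apply, so_smul_apply, smul_lie, lie_smul, smul_add,
        smul_sub]

namespace HasDeformedBracket

variable (hb : a.HasDeformedBracket κ β γ lam θ b)
include hb

lemma fst (x y : a.Carrier) :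
    (b x y).1 = ((x.2.2 : so η) : Module.End ℝ V) y.1 - ((y.2.2 : so η) : Module.End ℝ V) x.1 +
      κ.map x.2.1 y.2.1 +
        ((lam x.1 : Module.End ℝ V) y.1 - (lam y.1 : Module.End ℝ V) x.1) :=
  congrArg (fun z => z.1) (hb x y)

lemma odd (x y : a.Carrier) :
    ((b x y).2.1 : S) = spinAction η S x.2.2 y.2.1 - spinAction η S y.2.2 x.2.1 +
      (β x.1 y.2.1 + spinAction η S (lam x.1) y.2.1) -
        (β y.1 x.2.1 + spinAction η S (lam y.1) x.2.1) :=
  congrArg (fun z => z.2.1) (hb x y)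

lemma zero (x y : a.Carrier) :
    ((b x y).2.2 : so η) = ⁅(x.2.2 : so η), (y.2.2 : so η)⁆ +
      (⁅(x.2.2 : so η), lam y.1⁆ - lam (((x.2.2 : so η) : Module.End ℝ V) y.1)) -
      (⁅(y.2.2 : so η), lam x.1⁆ - lam (((y.2.2 : so η) : Module.End ℝ V) x.1)) +
      (γ x.2.1 y.2.1 - lam (κ.map x.2.1 y.2.1)) +
      (θ x.1 y.1 - lam ((lam x.1 : Module.End ℝ V) y.1 - (lam y.1 : Module.End ℝ V) x.1) +
        ⁅lam x.1, lam y.1⁆) :=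
  congrArg (fun z => z.2.2) (hb x y)

/-- After the shear `A ↦ A + λ(v)`, the `𝔰𝔬(V)`-component of the bracket does not involve `λ`. -/
lemma zero_add_lam (x y : a.Carrier) :
    ((b x y).2.2 : so η) + lam (b x y).1 = ⁅(x.2.2 : so η) + lam x.1, (y.2.2 : so η) + lam y.1⁆ +
      γ x.2.1 y.2.1 + θ x.1 y.1 := by
  rw [hb.zero, hb.fst]
  simp only [add_lie, lie_add, map_add, map_sub]
  rw [← lie_skew (lam x.1) (y.2.2 : so η)]
  abel

/-- In terms of `A + λ(v)` this is the undeformed formula; `λ` enters nowhere else. -/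
lemma fst_eq (x y : a.Carrier) :
    (b x y).1 = (((x.2.2 : so η) + lam x.1 : so η) : Module.End ℝ V) y.1 -
      (((y.2.2 : so η) + lam y.1 : so η) : Module.End ℝ V) x.1 + κ.map x.2.1 y.2.1 := by
  rw [hb.fst, so_add_apply, so_add_apply]
  abel

lemma odd_eq (x y : a.Carrier) :
    ((b x y).2.1 : S) = spinAction η S ((x.2.2 : so η) + lam x.1) y.2.1 + β x.1 y.2.1 -
      (spinAction η S ((y.2.2 : so η) + lam y.1) x.2.1 + β y.1 x.2.1) := by
  rw [hb.odd]
  simp only [map_add, LinearMap.add_apply]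
  abel

omit hb in
/-- Elements of `𝔞` are determined by their images under the shear `A ↦ A + λ(v)`. -/
lemma _root_.SpencerDeformation.GradedSubalgebra.ext_shear {x y : a.Carrier} (h₁ : x.1 = y.1)
    (h₂ : (x.2.1 : S) = y.2.1) (h₃ : (x.2.2 : so η) + lam x.1 = y.2.2 + lam y.1) : x = y := by
  rw [h₁, add_left_inj] at h₃
  exact Prod.ext h₁ (Prod.ext (Subtype.ext h₂) (Subtype.ext h₃))

lemma mem_even_even {x y : a.Carrier} (hx : x ∈ parityPart a.deg 0)
    (hy : y ∈ parityPart a.deg 0) : b x y ∈ parityPart a.deg 0 := by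
  rw [mem_parityPart_zero] at hx hy
  refine mem_parityPart_zero.mpr (Subtype.ext ?_)
  rw [hb.odd_eq, hx, hy]
  simp

lemma mem_even_odd {x y : a.Carrier} (hx : x ∈ parityPart a.deg 0)
    (hy : y ∈ parityPart a.deg 1) : b x y ∈ parityPart a.deg 1 := by
  rw [mem_parityPart_zero] at hx
  rw [mem_parityPart_one] at hy
  refine mem_parityPart_one.mpr ⟨?_, Subtype.ext ?_⟩
  · rw [hb.fst, hx, hy.1, hy.2]
    simp
  · rw [hb.zero, hx, hy.1, hy.2]
    simp

lemma mem_odd_even {x y : a.Carrier} (hx : x ∈ parityPart a.deg 1)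
    (hy : y ∈ parityPart a.deg 0) : b x y ∈ parityPart a.deg 1 := by
  rw [mem_parityPart_zero] at hy
  rw [mem_parityPart_one] at hx
  refine mem_parityPart_one.mpr ⟨?_, Subtype.ext ?_⟩
  · rw [hb.fst, hy, hx.1, hx.2]
    simp
  · rw [hb.zero, hy, hx.1, hx.2]
    simp

lemma mem_odd_odd {x y : a.Carrier} (hx : x ∈ parityPart a.deg 1)
    (hy : y ∈ parityPart a.deg 1) : b x y ∈ parityPart a.deg 0 := by
  rw [mem_parityPart_one] at hx hy
  refine mem_parityPart_zero.mpr (Subtype.ext ?_)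
  rw [hb.odd_eq, hx.1, hx.2, hy.1, hy.2]
  simp

lemma mem_parity (i j : ZMod 2) (x : a.Carrier) (hx : x ∈ parityPart a.deg i) (y : a.Carrier)
    (hy : y ∈ parityPart a.deg j) : b x y ∈ parityPart a.deg (i + j) := by
  have cases : ∀ i : ZMod 2, i = 0 ∨ i = 1 := by decide
  rcases cases i with rfl | rfl <;> rcases cases j with rfl | rfl
  · rw [zero_add]; exact hb.mem_even_even hx hy
  · rw [zero_add]; exact hb.mem_even_odd hx hy
  · rw [add_zero]; exact hb.mem_odd_even hx hy
  · rw [show (1 + 1 : ZMod 2) = 0 from rfl]; exact hb.mem_odd_odd hx hy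

/-- Once `x` has no spinor part, the symmetric terms `κ` and `γ` drop out, so `y` need not be
homogeneous. -/
lemma skew_of_even (hθ : ∀ v, θ v v = 0) {x y : a.Carrier} (hx : x ∈ parityPart a.deg 0) :
    b x y = -b y x := by
  rw [mem_parityPart_zero] at hx
  have hskew : θ y.1 x.1 = -θ x.1 y.1 := by
    have h := hθ (x.1 + y.1)
    simp only [map_add, LinearMap.add_apply, hθ, zero_add, add_zero] at h
    exact eq_neg_of_add_eq_zero_left h
  refine ext_shear (lam := lam) ?_ ?_ ?_
  · rw [Prod.fst_neg, hb.fst_eq, hb.fst_eq, hx]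
    simp only [Submodule.coe_zero, map_zero, LinearMap.zero_apply]
    abel
  · rw [Prod.snd_neg, Prod.fst_neg, Submodule.coe_neg, hb.odd_eq, hb.odd_eq]
    abel
  · rw [Prod.fst_neg, Prod.snd_neg, Prod.snd_neg, map_neg, coe_zero_neg, ← neg_add,
      hb.zero_add_lam, hb.zero_add_lam, hx, hskew, ← lie_skew]
    simp only [Submodule.coe_zero, map_zero, LinearMap.zero_apply]
    abel

lemma symm_of_odd (hγ : ∀ s t, γ s t = γ t s) {x y : a.Carrier} (hx : x ∈ parityPart a.deg 1)
    (hy : y ∈ parityPart a.deg 1) : b x y = b y x := by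
  rw [mem_parityPart_one] at hx hy
  refine ext_shear (lam := lam) ?_ ?_ ?_
  · simp [hb.fst_eq, hx.1, hx.2, hy.1, hy.2, κ.symm (x.2.1 : S)]
  · simp [hb.odd_eq, hx.1, hx.2, hy.1, hy.2]
  · simp [hb.zero_add_lam, hx.1, hx.2, hy.1, hy.2, hγ (x.2.1 : S)]

lemma odd_of_even {x y : a.Carrier} (hx : x.2.1 = 0) :
    ((b x y).2.1 : S) = spinAction η S ((x.2.2 : so η) + lam x.1) y.2.1 + β x.1 y.2.1 := by
  rw [hb.odd_eq, hx, Submodule.coe_zero, map_zero, map_zero, add_zero, sub_zero]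

lemma fst_of_even {x y : a.Carrier} (hx : x.2.1 = 0) :
    (b x y).1 = (((x.2.2 : so η) + lam x.1 : so η) : Module.End ℝ V) y.1 -
      (((y.2.2 : so η) + lam y.1 : so η) : Module.End ℝ V) x.1 := by
  rw [hb.fst_eq, hx, Submodule.coe_zero, map_zero, LinearMap.zero_apply, add_zero]

lemma shear_of_even {x y : a.Carrier} (hx : x.2.1 = 0) :
    ((b x y).2.2 : so η) + lam (b x y).1 = ⁅(x.2.2 : so η) + lam x.1, (y.2.2 : so η) + lam y.1⁆ +
      θ x.1 y.1 := by
  rw [hb.zero_add_lam, hx, Submodule.coe_zero, map_zero, LinearMap.zero_apply, add_zero]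

lemma fst_of_odd_odd {x y : a.Carrier} (hx : x.1 = 0 ∧ x.2.2 = 0) (hy : y.1 = 0 ∧ y.2.2 = 0) :
    (b x y).1 = κ.map x.2.1 y.2.1 := by
  rw [hb.fst_eq, hx.1, hy.1, map_zero, map_zero, sub_zero, zero_add]

lemma shear_of_odd_odd {x y : a.Carrier} (hx : x.1 = 0 ∧ x.2.2 = 0) (hy : y.1 = 0 ∧ y.2.2 = 0) :
    ((b x y).2.2 : so η) + lam (b x y).1 = γ x.2.1 y.2.1 := by
  rw [hb.zero_add_lam, hx.1, hy.1, hx.2, hy.2]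
  simp

end HasDeformedBracket

namespace IsCompatible

variable (h : a.IsCompatible κ β γ lam)
include h

/-- An even element acts on `S'` by `A + λ(v) + β(v,-)`, and this computes the commutator of two
such operators. Invariance of `β` under `𝔥` allows `λ(v)` to be replaced by `A + λ(v)` in the
curvature formula. -/
lemma curvature_identity
    (hcurv : ∀ v w, ∀ s ∈ a.odd, spinAction η S (θ v w) s =
      β v (β w s) - β w (β v s) + actβ (lam v) β w s - actβ (lam w) β v s)
    {A B : so η} (hA : A ∈ a.zero) (hB : B ∈ a.zero) (v w : V) {s : S} (hs : s ∈ a.odd) :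
    spinAction η S (A + lam v) (spinAction η S (B + lam w) s + β w s) +
        β v (spinAction η S (B + lam w) s + β w s) =
      spinAction η S (⁅A + lam v, B + lam w⁆ + θ v w) s +
          β (((A + lam v : so η) : Module.End ℝ V) w - ((B + lam w : so η) : Module.End ℝ V) v) s +
        (spinAction η S (B + lam w) (spinAction η S (A + lam v) s + β v s) +
          β w (spinAction η S (A + lam v) s + β v s)) := by
  have hinv : ∀ {C : so η}, C ∈ a.zero → ∀ u, actβ C β u s = 0 := fun hC u =>
    (h.invariant _ hC).1 u s
  have hadd : ∀ (C D : so η) (u : V), actβ (C + D) β u s = actβ C β u s + actβ D β u s := by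
    intro C D u
    simp only [actβ, map_add, LinearMap.add_apply, so_add_apply]
    abel
  have h1 : actβ (A + lam v) β w s = actβ (lam v) β w s := by rw [hadd, hinv hA, zero_add]
  have h2 : actβ (B + lam w) β v s = actβ (lam w) β v s := by rw [hadd, hinv hB, zero_add]
  rw [map_add (spinAction η S) ⁅A + lam v, B + lam w⁆, LinearMap.add_apply, hcurv v w s hs, ← h1,
    ← h2, spinAction_lie]
  simp only [actβ, map_add (spinAction η S (_ : so η)), map_add (β _), map_sub β,
    LinearMap.sub_apply]
  abel

lemma vector_identity (A : so η) (v : V) (s t : S) :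
    (A : Module.End ℝ V) (κ.map s t) - (γ s t : Module.End ℝ V) v =
      κ.map (spinAction η S A s + β v s) t + κ.map s (spinAction η S A t + β v t) := by
  rw [h.cocycle.apply_vector, κ.equivariant, map_add, map_add, LinearMap.add_apply]
  abel

/-- The definition of `Θ` accounts for the `λ(v)` part and the invariance of `γ` for the `A` part.
The result is the sheared `𝔰𝔬(V)`-component of the Jacobi identity with two odd arguments. -/
lemma theta_identity (hθ : a.FactorsTheta κ β γ lam θ) {A : so η} (hA : A ∈ a.zero) (v : V) {s t : S}
    (hs : s ∈ a.odd) (ht : t ∈ a.odd) :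
    ⁅A + lam v, γ s t⁆ + θ v (κ.map s t) =
      γ (spinAction η S (A + lam v) s + β v s) t + γ s (spinAction η S (A + lam v) t + β v t) := by
  rw [hθ v s hs t ht, Theta_apply_of_symm h.symm, add_lie, h.lie_γ hA]
  simp only [map_add, LinearMap.add_apply]
  abel

end IsCompatible

namespace HasDeformedBracket

variable (hb : a.HasDeformedBracket κ β γ lam θ b) (h : a.IsCompatible κ β γ lam)
include hb h

lemma jacobi_even_even_odd
    (hcurv : ∀ v w, ∀ s ∈ a.odd, spinAction η S (θ v w) s =
      β v (β w s) - β w (β v s) + actβ (lam v) β w s - actβ (lam w) β v s)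
    {x y z : a.Carrier} (hx : x ∈ parityPart a.deg 0) (hy : y ∈ parityPart a.deg 0)
    (hz : z ∈ parityPart a.deg 1) : b x (b y z) = b (b x y) z + b y (b x z) := by
  have hxy := hb.mem_even_even hx hy
  have hyz := hb.mem_even_odd hy hz
  have hxz := hb.mem_even_odd hx hz
  -- Both sides are odd, so only the `S'`-components have to be compared.
  have h1 := mem_parityPart_one.mp (sub_mem (hb.mem_even_odd hx hyz)
    (add_mem (hb.mem_even_odd hxy hz) (hb.mem_even_odd hy hxz)))
  refine sub_eq_zero.mp (Prod.ext h1.1 (Prod.ext (Subtype.ext ?_) h1.2))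
  change ((b x (b y z)).2.1 : S) - ((b (b x y) z).2.1 + (b y (b x z)).2.1) = 0
  replace hxy : (b x y).2.1 = 0 := mem_parityPart_zero.mp hxy
  replace hyz := mem_parityPart_one.mp hyz
  replace hxz := mem_parityPart_one.mp hxz
  replace hx := mem_parityPart_zero.mp hx
  replace hy := mem_parityPart_zero.mp hy
  replace hz := mem_parityPart_one.mp hz
  rw [hb.odd_of_even hx, hb.odd_of_even hy, hb.odd_of_even hxy,
    hb.odd_of_even hy, hb.odd_of_even hx, hb.shear_of_even hx,
    hb.fst_of_even hx, sub_eq_zero]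
  exact h.curvature_identity hcurv x.2.2.2 y.2.2.2 x.1 y.1 z.2.1.2

lemma jacobi_even_odd_odd (hθ : a.FactorsTheta κ β γ lam θ)
    {x y z : a.Carrier} (hx : x ∈ parityPart a.deg 0) (hy : y ∈ parityPart a.deg 1)
    (hz : z ∈ parityPart a.deg 1) : b x (b y z) = b (b x y) z + b y (b x z) := by
  have hyz := hb.mem_odd_odd hy hz
  have hxy := hb.mem_even_odd hx hy
  have hxz := hb.mem_even_odd hx hz
  have h1 := mem_parityPart_zero.mp (sub_mem (hb.mem_even_even hx hyz)
    (add_mem (hb.mem_odd_odd hxy hz) (hb.mem_odd_odd hy hxz)))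
  have h2 : (b x (b y z)).2.1 = (b (b x y) z).2.1 + (b y (b x z)).2.1 := sub_eq_zero.mp h1
  replace hxy := mem_parityPart_one.mp hxy
  replace hxz := mem_parityPart_one.mp hxz
  replace hx := mem_parityPart_zero.mp hx
  replace hy := mem_parityPart_one.mp hy
  replace hz := mem_parityPart_one.mp hz
  refine ext_shear (lam := lam) ?_ (congrArg Subtype.val h2) ?_
  · change (b x (b y z)).1 = (b (b x y) z).1 + (b y (b x z)).1
    rw [hb.fst_of_even hx, hb.shear_of_odd_odd hy hz, hb.fst_of_odd_odd hy hz,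
      hb.fst_of_odd_odd hxy hz, hb.fst_of_odd_odd hy hxz, hb.odd_of_even hx,
      hb.odd_of_even hx]
    exact h.vector_identity _ _ _ _
  · change ((b x (b y z)).2.2 : so η) + lam (b x (b y z)).1 =
      ((b (b x y) z).2.2 : so η) + (b y (b x z)).2.2 + lam ((b (b x y) z).1 + (b y (b x z)).1)
    rw [map_add lam, add_add_add_comm, hb.shear_of_even hx, hb.shear_of_odd_odd hy hz, hb.fst_of_odd_odd hy hz,
      hb.shear_of_odd_odd hxy hz, hb.shear_of_odd_odd hy hxz, hb.odd_of_even hx,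
      hb.odd_of_even hx]
    exact h.theta_identity hθ x.2.2.2 _ y.2.1.2 z.2.1.2

lemma jacobi_odd_odd_odd
    {x y z : a.Carrier} (hx : x ∈ parityPart a.deg 1) (hy : y ∈ parityPart a.deg 1)
    (hz : z ∈ parityPart a.deg 1) : b (b x y) z + b (b y z) x + b (b z x) y = 0 := by
  have hxy := hb.mem_odd_odd hx hy
  have hyz := hb.mem_odd_odd hy hz
  have hzx := hb.mem_odd_odd hz hx
  have h1 := mem_parityPart_one.mp (add_mem (add_mem (hb.mem_even_odd hxy hz)
    (hb.mem_even_odd hyz hx)) (hb.mem_even_odd hzx hy))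
  refine Prod.ext h1.1 (Prod.ext (Subtype.ext ?_) h1.2)
  change ((b (b x y) z).2.1 : S) + (b (b y z) x).2.1 + (b (b z x) y).2.1 = 0
  replace hxy := mem_parityPart_zero.mp hxy
  replace hyz := mem_parityPart_zero.mp hyz
  replace hzx := mem_parityPart_zero.mp hzx
  replace hx := mem_parityPart_one.mp hx
  replace hy := mem_parityPart_one.mp hy
  replace hz := mem_parityPart_one.mp hz
  rw [hb.odd_of_even hxy, hb.odd_of_even hyz, hb.odd_of_even hzx,
    hb.shear_of_odd_odd hx hy, hb.shear_of_odd_odd hy hz, hb.shear_of_odd_odd hz hx,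
    hb.fst_of_odd_odd hx hy, hb.fst_of_odd_odd hy hz, hb.fst_of_odd_odd hz hx]
  have := h.cocycle.apply_spinor x.2.1 y.2.1 z.2.1
  rw [eq_neg_iff_add_eq_zero] at this
  refine Eq.trans ?_ this
  abel

end HasDeformedBracket

end GradedSubalgebra

end DeformedBracket

/-! ### Filtered deformation and its degree-two part -/

section FilteredDeformation

variable {V : Type*} [AddCommGroup V] [Module ℝ V] [FiniteDimensional ℝ V] {η : LorentzianForm V}
variable {S : Type*} [AddCommGroup S] [Module ℝ S]
  [Module (EvenClifford η) S] [IsScalarTower ℝ (EvenClifford η) S]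

local instance : AddCommMonoid (so η) := inferInstance
local instance : AddCommGroup (so η) := inferInstance
local instance : AddMonoid (so η) := inferInstance

variable {κ : SquaringMap η S} {β β' : V →ₗ[ℝ] S →ₗ[ℝ] S} {γ γ' : S →ₗ[ℝ] S →ₗ[ℝ] so η}
  {lam lam' : V →ₗ[ℝ] so η} {θ θ' : V →ₗ[ℝ] V →ₗ[ℝ] so η}

namespace GradedSubalgebra

variable {a : GradedSubalgebra η S}

local instance : AddCommMonoid a.Carrier := inferInstance
local instance : AddCommGroup a.Carrier := inferInstance
local instance : AddCommMonoid a.zero := inferInstance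
local instance : AddCommGroup a.zero := inferInstance
local instance : AddMonoid a.zero := inferInstance

variable {b b' : a.Carrier →ₗ[ℝ] a.Carrier →ₗ[ℝ] a.Carrier}

namespace HasDeformedBracket

variable (hb : a.HasDeformedBracket κ β γ lam θ b)
include hb

lemma apply_zero_zero (A B : a.zero) : b (0, 0, A) (0, 0, B) = (0, 0, ⁅A, B⁆) := by
  refine Prod.ext ?_ (Prod.ext (Subtype.ext ?_) (Subtype.ext ?_))
  · rw [hb.fst]; simp
  · rw [hb.odd]; simp
  · rw [hb.zero]; simp

lemma isLieSuperbracket (hsp : a.Spans κ) (h : a.IsCompatible κ β γ lam)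
    (hθ : a.FactorsTheta κ β γ lam θ)
    (hcurv : ∀ v w, ∀ s ∈ a.odd, spinAction η S (θ v w) s =
      β v (β w s) - β w (β v s) + actβ (lam v) β w s - actβ (lam w) β v s) :
    IsLieSuperbracket (parityPart a.deg) b := by
  have halt := FactorsTheta.alternating hsp hcurv
  refine IsLieSuperbracket.of_odd_generated hb.mem_parity
    (fun x hx _ y _ => hb.skew_of_even halt hx) (fun x hx y hy => hb.symm_of_odd h.symm hx hy)
    (fun x hx y hy z hz => hb.jacobi_even_even_odd h hcurv hx hy hz)
    (fun x hx y hy z hz => hb.jacobi_even_odd_odd h hθ hx hy hz)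
    (fun x hx y hy z hz => hb.jacobi_odd_odd_odd h hx hy hz)
    (LinearMap.range (LinearMap.inr ℝ V (a.odd × a.zero) ∘ₗ LinearMap.inr ℝ a.odd a.zero)) ?_ ?_ ?_
  · rintro _ ⟨A, rfl⟩
    exact mem_parityPart_zero.mpr rfl
  · rintro _ ⟨A, rfl⟩ _ ⟨B, rfl⟩ _ ⟨C, rfl⟩
    change b (0, 0, A) (b (0, 0, B) (0, 0, C)) =
      b (b (0, 0, A) (0, 0, B)) (0, 0, C) + b (0, 0, B) (b (0, 0, A) (0, 0, C))
    simp only [hb.apply_zero_zero]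
    rw [leibniz_lie]
    simp
  · intro x hx
    rw [mem_parityPart_zero] at hx
    -- By surjectivity of `κ`, a sum of brackets of odd elements has the same `V`-component as `x`;
    -- what remains of `x` lies in `𝔥`.
    obtain ⟨u, hu, h1, h2⟩ : ∃ u ∈ Submodule.span ℝ
        {u | ∃ s ∈ parityPart a.deg 1, ∃ t ∈ parityPart a.deg 1, u = b s t},
        u.1 = x.1 ∧ u.2.1 = 0 := by
      refine hsp.induction (P := fun v => ∃ u ∈ Submodule.span ℝ
        {u | ∃ s ∈ parityPart a.deg 1, ∃ t ∈ parityPart a.deg 1, u = b s t},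
        u.1 = v ∧ u.2.1 = 0) ⟨0, zero_mem _, rfl, rfl⟩ ?_ ?_ x.1
      · rintro _ _ ⟨u, hu, rfl, hu2⟩ ⟨w, hw, rfl, hw2⟩
        exact ⟨u + w, add_mem hu hw, rfl, by rw [Prod.snd_add, Prod.fst_add, hu2, hw2, add_zero]⟩
      · intro s hs t ht
        have hs' : ((0, ⟨s, hs⟩, 0) : a.Carrier) ∈ parityPart a.deg 1 :=
          mem_parityPart_one.mpr ⟨rfl, rfl⟩
        have ht' : ((0, ⟨t, ht⟩, 0) : a.Carrier) ∈ parityPart a.deg 1 :=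
          mem_parityPart_one.mpr ⟨rfl, rfl⟩
        exact ⟨_, Submodule.subset_span ⟨_, hs', _, ht', rfl⟩,
          hb.fst_of_odd_odd ⟨rfl, rfl⟩ ⟨rfl, rfl⟩, mem_parityPart_zero.mp (hb.mem_odd_odd hs' ht')⟩
    refine ⟨(0, 0, x.2.2 - u.2.2), ⟨_, rfl⟩, ?_⟩
    convert hu using 1
    refine Prod.ext ?_ (Prod.ext ?_ ?_)
    · simp [h1]
    · simp [h2, hx]
    · simp

/-- Every correction term has degree at least `2`. Whenever the filtration bound requires a
component to vanish, each correction to it has a zero argument. -/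
lemma sub_bracket_mem_filtrationOf {k l : ℤ} {x y : a.Carrier}
    (hx : x ∈ filtrationOf a.deg k) (hy : y ∈ filtrationOf a.deg l) :
    b x y - a.bracket κ x y ∈ filtrationOf a.deg (k + l + 1) := by
  obtain ⟨hx1, hx2, hx3⟩ := mem_filtrationOf_grading.mp hx
  obtain ⟨hy1, hy2, hy3⟩ := mem_filtrationOf_grading.mp hy
  have hV : ∀ v w : V, v = 0 ∨ w = 0 →
      (lam v : Module.End ℝ V) w - (lam w : Module.End ℝ V) v = 0 := by
    rintro v w (rfl | rfl) <;> simp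
  have hVS : ∀ (v : V) (t : S), v = 0 ∨ t = 0 → β v t + spinAction η S (lam v) t = 0 := by
    rintro v w (rfl | rfl) <;> simp
  have hVH : ∀ (A : so η) (v : V), A = 0 ∨ v = 0 →
      ⁅A, lam v⁆ - lam ((A : Module.End ℝ V) v) = 0 := by
    rintro v w (rfl | rfl) <;> simp
  have hSS : ∀ s t : S, s = 0 ∨ t = 0 → γ s t - lam (κ.map s t) = 0 := by
    rintro v w (rfl | rfl) <;> simp
  have hVV : ∀ v w : V, v = 0 ∨ w = 0 → θ v w + ⁅lam v, lam w⁆ = 0 := by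
    rintro v w (rfl | rfl) <;> simp
  refine mem_filtrationOf_grading.mpr ⟨fun hkl => ?_, fun hkl => Subtype.ext ?_,
    fun hkl => Subtype.ext ?_⟩
  · change (b x y).1 - _ = 0
    rw [hb.fst, hV x.1 y.1 ((by omega : -2 < k ∨ -2 < l).imp hx1 hy1), add_zero]
    exact sub_self _
  · change ((b x y).2.1 : S) - _ = 0
    rw [hb.odd, hVS x.1 y.2.1 ((by omega : -2 < k ∨ -1 < l).imp hx1 fun h => by rw [hy2 h]; rfl),
      hVS y.1 x.2.1 ((by omega : -2 < l ∨ -1 < k).imp hy1 fun h => by rw [hx2 h]; rfl), add_zero,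
      sub_zero]
    exact sub_self _
  · change ((b x y).2.2 : so η) - _ = 0
    have hv := (by omega : -2 < k ∨ -2 < l).imp hx1 hy1
    rw [hb.zero, hVH x.2.2 y.1 ((by omega : 0 < k ∨ -2 < l).imp (fun h => by rw [hx3 h]; rfl) hy1),
      hVH y.2.2 x.1 ((by omega : 0 < l ∨ -2 < k).imp (fun h => by rw [hy3 h]; rfl) hx1),
      hSS x.2.1 y.2.1 ((by omega : -1 < k ∨ -1 < l).imp (fun h => by rw [hx2 h]; rfl)
        fun h => by rw [hy2 h]; rfl),
      hV x.1 y.1 hv, map_zero, sub_zero (θ x.1 y.1), hVV x.1 y.1 hv, add_zero, sub_zero, add_zero,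
      add_zero]
    exact sub_self _

omit hb in
lemma _root_.SpencerDeformation.GradedSubalgebra.bracket_mem_filtrationOf {k l : ℤ}
    {x y : a.Carrier} (hx : x ∈ filtrationOf a.deg k) (hy : y ∈ filtrationOf a.deg l) :
    a.bracket κ x y ∈ filtrationOf a.deg (k + l) := by
  obtain ⟨hx1, hx2, hx3⟩ := mem_filtrationOf_grading.mp hx
  obtain ⟨hy1, hy2, hy3⟩ := mem_filtrationOf_grading.mp hy
  have hHV : ∀ (A : so η) (v : V), A = 0 ∨ v = 0 → (A : Module.End ℝ V) v = 0 := by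
    rintro A v (rfl | rfl) <;> simp
  have hHS : ∀ (A : so η) (s : S), A = 0 ∨ s = 0 → spinAction η S A s = 0 := by
    rintro A v (rfl | rfl) <;> simp
  have hHH : ∀ A B : so η, A = 0 ∨ B = 0 → ⁅A, B⁆ = 0 := by
    rintro A v (rfl | rfl) <;> simp
  have hSS : ∀ s t : S, s = 0 ∨ t = 0 → κ.map s t = 0 := by
    rintro A v (rfl | rfl) <;> simp
  have cS : ∀ {s : a.odd}, s = 0 → (s : S) = 0 := fun h => by rw [h]; rfl
  have cH : ∀ {A : a.zero}, A = 0 → (A : so η) = 0 := fun h => by rw [h]; rfl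
  refine mem_filtrationOf_grading.mpr ⟨fun hkl => ?_, fun hkl => Subtype.ext ?_,
    fun hkl => Subtype.ext ?_⟩
  · change ((x.2.2 : so η) : Module.End ℝ V) y.1 - ((y.2.2 : so η) : Module.End ℝ V) x.1 +
      κ.map x.2.1 y.2.1 = 0
    rw [hHV _ _ ((by omega : 0 < k ∨ -2 < l).imp (fun h => cH (hx3 h)) hy1),
      hHV _ _ ((by omega : 0 < l ∨ -2 < k).imp (fun h => cH (hy3 h)) hx1),
      hSS _ _ ((by omega : -1 < k ∨ -1 < l).imp (fun h => cS (hx2 h)) fun h => cS (hy2 h)),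
      sub_zero, add_zero]
  · change spinAction η S x.2.2 y.2.1 - spinAction η S y.2.2 x.2.1 = 0
    rw [hHS _ _ ((by omega : 0 < k ∨ -1 < l).imp (fun h => cH (hx3 h)) fun h => cS (hy2 h)),
      hHS _ _ ((by omega : 0 < l ∨ -1 < k).imp (fun h => cH (hy3 h)) fun h => cS (hx2 h)),
      sub_zero]
  · change ⁅(x.2.2 : so η), (y.2.2 : so η)⁆ = 0
    exact hHH _ _ ((by omega : 0 < k ∨ 0 < l).imp (fun h => cH (hx3 h)) fun h => cH (hy3 h))

omit hb in
lemma _root_.SpencerDeformation.grading_le_filtrationOf {k l : ℤ} (h : k ≤ l) :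
    a.deg l ≤ filtrationOf a.deg k :=
  le_iSup₂_of_le (f := fun (l : ℤ) (_ : k ≤ l) => a.deg l) l h le_rfl

lemma isFilteredDeformation (hlie : IsLieSuperbracket (parityPart a.deg) b) :
    IsFilteredDeformation a.deg (a.bracket κ) b where
  lie := hlie
  filtered k l x hx y hy := by
    have h1 := mem_filtrationOf_grading.mp (hb.sub_bracket_mem_filtrationOf hx hy)
    have h2 := add_mem (mem_filtrationOf_grading.mpr ⟨fun h => h1.1 (by omega),
      fun h => h1.2.1 (by omega), fun h => h1.2.2 (by omega)⟩)
      (bracket_mem_filtrationOf (κ := κ) hx hy)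
    rwa [sub_add_cancel] at h2
  gr k l x hx y hy := hb.sub_bracket_mem_filtrationOf (grading_le_filtrationOf le_rfl hx)
    (grading_le_filtrationOf le_rfl hy)

variable {φ : a.Neg →ₗ[ℝ] a.Neg →ₗ[ℝ] a.Carrier}

/-- Two vectors have total degree `-4`, so the comparison is modulo filtration degree `-4 + 3 = -1`.
The `𝔥`-valued terms, including `θ`, are of degree `4` and are not seen. -/
lemma sub_mem_of_vector_vector (h : a.IsParametrisation κ φ β γ lam) (v w : V) :
    b (v, 0, 0) (w, 0, 0) - a.bracket κ (v, 0, 0) (w, 0, 0) - φ (v, 0) (w, 0) ∈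
      filtrationOf a.deg (-1) := by
  have e : (φ (v, 0) (w, 0)).1 = (lam v : Module.End ℝ V) w - (lam w : Module.End ℝ V) v :=
    congrArg (fun z => z.1) (h.incl_vector_vector v w)
  refine mem_filtrationOf_grading.mpr ⟨fun _ => ?_, fun h => absurd h (by norm_num),
    fun h => absurd h (by norm_num)⟩
  change (b (v, 0, 0) (w, 0, 0)).1 - (a.bracket κ (v, 0, 0) (w, 0, 0)).1 -
    (φ (v, 0) (w, 0)).1 = 0
  rw [e, hb.fst]
  simp [bracket]

lemma sub_mem_of_vector_spinor (h : a.IsParametrisation κ φ β γ lam) (v : V) (s : a.odd) :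
    b (v, 0, 0) (0, s, 0) - a.bracket κ (v, 0, 0) (0, s, 0) - φ (v, 0) (0, s) ∈
      filtrationOf a.deg 0 := by
  have h1 := h.incl_vector_spinor v s
  have e1 : (φ (v, 0) (0, s)).1 = 0 := congrArg (fun z => z.1) h1
  have e2 : ((φ (v, 0) (0, s)).2.1 : S) = β v s + spinAction η S (lam v) s :=
    congrArg (fun z => z.2.1) h1
  refine mem_filtrationOf_grading.mpr ⟨fun _ => ?_, fun _ => Subtype.ext ?_,
    fun h => absurd h (lt_irrefl _)⟩
  · change (b (v, 0, 0) (0, s, 0)).1 - (a.bracket κ (v, 0, 0) (0, s, 0)).1 -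
      (φ (v, 0) (0, s)).1 = 0
    rw [e1, hb.fst]
    simp [bracket]
  · change ((b (v, 0, 0) (0, s, 0)).2.1 : S) - (a.bracket κ (v, 0, 0) (0, s, 0)).2.1 -
      (φ (v, 0) (0, s)).2.1 = 0
    rw [e2, hb.odd]
    simp [bracket]

lemma sub_mem_of_spinor_vector (hφ : ∀ (s : a.odd) (w : V), φ (0, s) (w, 0) = -φ (w, 0) (0, s))
    (h : a.IsParametrisation κ φ β γ lam) (s : a.odd) (w : V) :
    b (0, s, 0) (w, 0, 0) - a.bracket κ (0, s, 0) (w, 0, 0) - φ (0, s) (w, 0) ∈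
      filtrationOf a.deg 0 := by
  have h1 := h.incl_vector_spinor w s
  have e1 : (φ (w, 0) (0, s)).1 = 0 := congrArg (fun z => z.1) h1
  have e2 : ((φ (w, 0) (0, s)).2.1 : S) = β w s + spinAction η S (lam w) s :=
    congrArg (fun z => z.2.1) h1
  rw [hφ]
  refine mem_filtrationOf_grading.mpr ⟨fun _ => ?_, fun _ => Subtype.ext ?_,
    fun h => absurd h (lt_irrefl _)⟩
  · change (b (0, s, 0) (w, 0, 0)).1 - (a.bracket κ (0, s, 0) (w, 0, 0)).1 -
      -(φ (w, 0) (0, s)).1 = 0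
    rw [e1, hb.fst]
    simp [bracket]
  · change ((b (0, s, 0) (w, 0, 0)).2.1 : S) - (a.bracket κ (0, s, 0) (w, 0, 0)).2.1 -
      -((φ (w, 0) (0, s)).2.1 : S) = 0
    rw [e2, hb.odd]
    simp [bracket]

/-- Agreement must be exact here, since filtration degree `-2 + 3 = 1` is already zero. -/
lemma sub_eq_zero_of_spinor_spinor (h : a.IsParametrisation κ φ β γ lam) (s t : a.odd) :
    b (0, s, 0) (0, t, 0) - a.bracket κ (0, s, 0) (0, t, 0) - φ (0, s) (0, t) = 0 := by
  have e := h.incl_spinor_spinor s t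
  have e1 : (φ (0, s) (0, t)).1 = 0 := congrArg (fun z => z.1) e
  have e2 : ((φ (0, s) (0, t)).2.1 : S) = 0 := congrArg (fun z => z.2.1) e
  have e3 : ((φ (0, s) (0, t)).2.2 : so η) = γ s t - lam (κ.map s t) :=
    congrArg (fun z => z.2.2) e
  refine Prod.ext ?_ (Prod.ext (Subtype.ext ?_) (Subtype.ext ?_))
  · change (b (0, s, 0) (0, t, 0)).1 - (a.bracket κ (0, s, 0) (0, t, 0)).1 -
      (φ (0, s) (0, t)).1 = 0
    rw [e1, hb.fst]
    simp [bracket]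
  · change ((b (0, s, 0) (0, t, 0)).2.1 : S) - (a.bracket κ (0, s, 0) (0, t, 0)).2.1 -
      (φ (0, s) (0, t)).2.1 = 0
    rw [e2, hb.odd]
    simp [bracket]
  · change ((b (0, s, 0) (0, t, 0)).2.2 : so η) - (a.bracket κ (0, s, 0) (0, t, 0)).2.2 -
      (φ (0, s) (0, t)).2.2 = 0
    rw [e3, hb.zero]
    simp [bracket]

omit hb in
lemma _root_.SpencerDeformation.eq_of_mem_negGrading {k : ℤ} {x : a.Neg}
    (hx : x ∈ negGrading V a.odd k) :
    (k = -2 ∧ ∃ v, x = (v, 0)) ∨ (k = -1 ∧ ∃ s, x = (0, s)) ∨ x = 0 := by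
  by_cases h2 : k = -2
  · exact Or.inl ⟨h2, x.1, Prod.ext rfl (hx.2 (by omega))⟩
  by_cases h1 : k = -1
  · exact Or.inr (Or.inl ⟨h1, x.2, Prod.ext (hx.1 h2) rfl⟩)
  · exact Or.inr (Or.inr (Prod.ext (hx.1 h2) (hx.2 h1)))

lemma isDegreeTwoPart (hφ : IsCochain₂ (negGrading V a.odd) a.deg 2 φ)
    (h : a.IsParametrisation κ φ β γ lam) : a.IsDegreeTwoPart κ b φ := by
  intro k l x hx y hy
  refine ⟨(hφ k l x hx y hy).1, ?_⟩
  have hskew : ∀ (s : a.odd) (w : V), φ (0, s) (w, 0) = -φ (w, 0) (0, s) := by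
    intro s w
    have := (hφ (-1) (-2) _ (right_mem_negGrading s) _ (left_mem_negGrading w)).2
    rwa [intCast_neg_two, superSign_zero_right, one_smul] at this
  rcases eq_of_mem_negGrading hx with ⟨rfl, v, rfl⟩ | ⟨rfl, s, rfl⟩ | rfl
  · rcases eq_of_mem_negGrading hy with ⟨rfl, w, rfl⟩ | ⟨rfl, t, rfl⟩ | rfl
    · exact hb.sub_mem_of_vector_vector h v w
    · exact hb.sub_mem_of_vector_spinor h v t
    · rw [map_zero, map_zero, map_zero, map_zero, sub_zero, sub_zero]
      exact zero_mem _
  · rcases eq_of_mem_negGrading hy with ⟨rfl, w, rfl⟩ | ⟨rfl, t, rfl⟩ | rfl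
    · exact hb.sub_mem_of_spinor_vector hskew h s w
    · have h0 : b (negIncl V a.odd a.zero (0, s)) (negIncl V a.odd a.zero (0, t)) -
          a.bracket κ (negIncl V a.odd a.zero (0, s)) (negIncl V a.odd a.zero (0, t)) -
          φ (0, s) (0, t) = 0 := hb.sub_eq_zero_of_spinor_spinor h s t
      rw [h0]
      exact zero_mem _
    · rw [map_zero, map_zero, map_zero, map_zero, sub_zero, sub_zero]
      exact zero_mem _
  · simp only [map_zero, LinearMap.zero_apply, sub_zero]
    exact zero_mem _

end HasDeformedBracket

end GradedSubalgebra

end FilteredDeformation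

/-! ### Classification of the isomorphisms between deformations -/

section Isomorphisms

variable {V : Type*} [AddCommGroup V] [Module ℝ V] [FiniteDimensional ℝ V] {η : LorentzianForm V}
variable {S : Type*} [AddCommGroup S] [Module ℝ S]
  [Module (EvenClifford η) S] [IsScalarTower ℝ (EvenClifford η) S]
variable {κ : SquaringMap η S} {β β' : V →ₗ[ℝ] S →ₗ[ℝ] S} {γ γ' : S →ₗ[ℝ] S →ₗ[ℝ] so η}
  {lam lam' : V →ₗ[ℝ] so η} {θ θ' : V →ₗ[ℝ] V →ₗ[ℝ] so η}

namespace GradedSubalgebra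

variable {a : GradedSubalgebra η S} {b b' : a.Carrier →ₗ[ℝ] a.Carrier →ₗ[ℝ] a.Carrier}

lemma coe_zero_zero : ((0 : a.zero) : so η) = 0 := rfl

/-- The nilpotent endomorphism `(v,s,A) ↦ (0,0,ψ(v))` of `𝔞`. -/
def shearPart (ψ : V →ₗ[ℝ] a.zero) : a.Carrier →ₗ[ℝ] a.Carrier :=
  LinearMap.inr ℝ V (a.odd × a.zero) ∘ₗ LinearMap.inr ℝ a.odd a.zero ∘ₗ ψ ∘ₗ
    LinearMap.fst ℝ V (a.odd × a.zero)

lemma shearPart_apply (ψ : V →ₗ[ℝ] a.zero) (x : a.Carrier) :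
    shearPart ψ x = (0, 0, ψ x.1) := rfl

lemma shearPart_shearPart (ψ χ : V →ₗ[ℝ] a.zero) (x : a.Carrier) :
    shearPart ψ (shearPart χ x) = 0 := by
  rw [shearPart_apply, shearPart_apply, map_zero]
  rfl

/-- The automorphism `(v,s,A) ↦ (v,s,A + ψ(v))` of the filtered space `𝔞`. -/
def shearEquiv (ψ : V →ₗ[ℝ] a.zero) : a.Carrier ≃ₗ[ℝ] a.Carrier where
  toLinearMap := LinearMap.id + shearPart ψ
  invFun x := x - shearPart ψ x
  left_inv x := by
    change x + shearPart ψ x - shearPart ψ (x + shearPart ψ x) = x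
    rw [map_add, shearPart_shearPart, add_zero, add_sub_cancel_right]
  right_inv x := by
    change x - shearPart ψ x + shearPart ψ (x - shearPart ψ x) = x
    rw [map_sub, shearPart_shearPart, sub_zero, sub_add_cancel]

lemma shearEquiv_apply (ψ : V →ₗ[ℝ] a.zero) (x : a.Carrier) :
    shearEquiv ψ x = x + shearPart ψ x := rfl

lemma shearPart_mem_filtrationOf (ψ : V →ₗ[ℝ] a.zero) {k : ℤ} {x : a.Carrier}
    (hx : x ∈ filtrationOf a.deg k) : shearPart ψ x ∈ filtrationOf a.deg k := by
  refine mem_filtrationOf_grading.mpr ⟨fun _ => rfl, fun _ => rfl, fun h => ?_⟩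
  rw [shearPart_apply, (mem_filtrationOf_grading.mp hx).1 (by omega), map_zero]

lemma shearEquiv_map_filtrationOf (ψ : V →ₗ[ℝ] a.zero) (k : ℤ) :
    (filtrationOf a.deg k).map (shearEquiv ψ : a.Carrier →ₗ[ℝ] a.Carrier) =
      filtrationOf a.deg k := by
  refine le_antisymm ?_ fun x hx => ?_
  · rintro _ ⟨x, hx, rfl⟩
    exact add_mem hx (shearPart_mem_filtrationOf ψ hx)
  · exact ⟨(shearEquiv ψ).symm x, sub_mem hx (shearPart_mem_filtrationOf ψ hx),
      (shearEquiv ψ).apply_symm_apply x⟩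

lemma shearEquiv_even (ψ : V →ₗ[ℝ] a.zero) (ε : ZMod 2) (x : a.Carrier)
    (hx : x ∈ parityPart a.deg ε) : shearEquiv ψ x ∈ parityPart a.deg ε := by
  have cases : ∀ i : ZMod 2, i = 0 ∨ i = 1 := by decide
  refine add_mem hx ?_
  rcases cases ε with rfl | rfl
  · exact mem_parityPart_zero.mpr rfl
  · refine mem_parityPart_one.mpr ⟨rfl, ?_⟩
    rw [shearPart_apply, (mem_parityPart_one.mp hx).1, map_zero]

lemma shearEquiv_gr (ψ : V →ₗ[ℝ] a.zero) (k : ℤ) (x : a.Carrier) (hx : x ∈ a.deg k) :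
    shearEquiv ψ x - x ∈ filtrationOf a.deg (k + 1) := by
  rw [shearEquiv_apply, add_sub_cancel_left]
  refine mem_filtrationOf_grading.mpr ⟨fun _ => rfl, fun _ => rfl, fun h => ?_⟩
  rw [shearPart_apply, hx.1 (by omega), map_zero]

section

variable {ψ : V →ₗ[ℝ] a.zero} (hψ : ∀ v, (ψ v : so η) + lam' v = lam v)
  (hb : a.HasDeformedBracket κ β γ lam θ b) (hb' : a.HasDeformedBracket κ β' γ' lam' θ' b')

lemma shearEquiv_fst (x : a.Carrier) : (shearEquiv ψ x).1 = x.1 := add_zero _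

lemma shearEquiv_odd (x : a.Carrier) : (shearEquiv ψ x).2.1 = x.2.1 := add_zero _

include hψ

/-- The shear by `λ - λ'` carries the coordinate `A + λ(v)` to `A + λ'(v)`. In these coordinates the
two brackets have the same form. -/
lemma shearEquiv_zero (x : a.Carrier) :
    ((shearEquiv ψ x).2.2 : so η) + lam' x.1 = x.2.2 + lam x.1 := by
  rw [← hψ, ← add_assoc]
  rfl

include hb hb'

lemma fst_bracket_shearEquiv (x y : a.Carrier) :
    (b' (shearEquiv ψ x) (shearEquiv ψ y)).1 = (b x y).1 := by
  rw [hb'.fst_eq, hb.fst_eq, shearEquiv_fst, shearEquiv_fst, shearEquiv_odd, shearEquiv_odd,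
    shearEquiv_zero hψ, shearEquiv_zero hψ]

lemma odd_bracket_shearEquiv (hβ : ∀ (v : V) (s : a.odd), β' v s = β v s) (x y : a.Carrier) :
    ((b' (shearEquiv ψ x) (shearEquiv ψ y)).2.1 : S) = (b x y).2.1 := by
  rw [hb'.odd_eq, hb.odd_eq, shearEquiv_fst, shearEquiv_fst, shearEquiv_odd, shearEquiv_odd,
    shearEquiv_zero hψ, shearEquiv_zero hψ, hβ, hβ]

lemma zero_bracket_shearEquiv (hγ : ∀ s t : a.odd, γ' s t = γ s t) (hθ : ∀ v w, θ v w = θ' v w)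
    (x y : a.Carrier) : ((b' (shearEquiv ψ x) (shearEquiv ψ y)).2.2 : so η) +
      lam' (b' (shearEquiv ψ x) (shearEquiv ψ y)).1 = (b x y).2.2 + lam (b x y).1 := by
  rw [hb'.zero_add_lam, hb.zero_add_lam, shearEquiv_fst, shearEquiv_fst, shearEquiv_odd,
    shearEquiv_odd, shearEquiv_zero hψ, shearEquiv_zero hψ, hγ, hθ]

lemma shearEquiv_bracket (hβ : ∀ (v : V) (s : a.odd), β' v s = β v s)
    (hγ : ∀ s t : a.odd, γ' s t = γ s t) (hθ : ∀ v w, θ v w = θ' v w) (x y : a.Carrier) :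
    shearEquiv ψ (b x y) = b' (shearEquiv ψ x) (shearEquiv ψ y) := by
  refine ext_shear (lam := lam') ?_ ?_ ?_
  · rw [shearEquiv_fst, fst_bracket_shearEquiv hψ hb hb']
  · rw [shearEquiv_odd, odd_bracket_shearEquiv hψ hb hb' hβ]
  · rw [shearEquiv_fst, shearEquiv_zero hψ, zero_bracket_shearEquiv hψ hb hb' hγ hθ]

end

namespace MemK

variable (hK : a.MemK κ (β' - β) (γ' - γ))
include hK

lemma β_eq (v : V) {s : S} (hs : s ∈ a.odd) : β' v s = β v s :=
  sub_eq_zero.mp (hK.2 v s hs)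

/-- The difference is itself a cocycle, whose `γ` is determined by its `β`, and that `β` vanishes on
`S'`. -/
lemma γ_eq {s t : S} (hs : s ∈ a.odd) (ht : t ∈ a.odd) : γ' s t = γ s t := by
  refine sub_eq_zero.mp (Subtype.ext (LinearMap.ext fun v => ?_))
  refine (hK.1.apply_vector v s t).trans ?_
  rw [hK.2 v s hs, hK.2 v t ht, map_zero, map_zero, LinearMap.zero_apply, add_zero, neg_zero]
  rfl

variable (hsp : a.Spans κ) (h : a.IsCompatible κ β γ lam) (h' : a.IsCompatible κ β' γ' lam')
include hsp h h'

/-- On `v = κ(s,t)` the common value of `γ` cancels, leaving a difference of two `𝔥`-valued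
expressions. -/
lemma lam_sub_mem (v : V) : lam v - lam' v ∈ a.zero := by
  refine hsp.induction (P := fun v => lam v - lam' v ∈ a.zero) (by simp) (fun v w hv hw => ?_)
    (fun s hs t ht => ?_) v
  · rw [map_add, map_add, add_sub_add_comm]
    exact add_mem hv hw
  · convert sub_mem (h'.mem_zero s hs t ht) (h.mem_zero s hs t ht) using 1
    rw [hK.γ_eq hs ht]
    abel

lemma theta_eq (hθ : a.FactorsTheta κ β γ lam θ) (hθ' : a.FactorsTheta κ β' γ' lam' θ')
    (v w : V) : θ v w = θ' v w := by
  refine hsp.induction (P := fun w => θ v w = θ' v w) (by simp)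
    (fun w₁ w₂ h₁ h₂ => by rw [map_add, map_add, h₁, h₂]) (fun s hs t ht => ?_) w
  -- With `A = λ'(v) - λ(v)` in `𝔥`, `theta_identity` absorbs the change from `λ` to `λ'`.
  have hmem : lam' v - lam v ∈ a.zero := by
    rw [← neg_sub]
    exact neg_mem (hK.lam_sub_mem hsp h h' v)
  have h1 := h.theta_identity hθ hmem v hs ht
  rw [sub_add_cancel] at h1
  rw [hθ' v s hs t ht, Theta_apply_of_symm h'.symm, hK.γ_eq (h'.stable v s hs) ht,
    hK.γ_eq hs (h'.stable v t ht), hK.γ_eq hs ht, hK.β_eq v hs, hK.β_eq v ht,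
    add_comm (β v s), add_comm (β v t), ← h1, add_sub_cancel_left]

lemma nonempty_deformationIso (hθ : a.FactorsTheta κ β γ lam θ)
    (hθ' : a.FactorsTheta κ β' γ' lam' θ') (hb : a.HasDeformedBracket κ β γ lam θ b)
    (hb' : a.HasDeformedBracket κ β' γ' lam' θ' b') : Nonempty (DeformationIso a.deg b b') := by
  let ψ : V →ₗ[ℝ] a.zero :=
    LinearMap.codRestrict a.zero.toSubmodule (lam - lam') (hK.lam_sub_mem hsp h h')
  exact ⟨⟨shearEquiv ψ, shearEquiv_bracket (fun v => sub_add_cancel _ _) hb hb'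
    (fun v s => hK.β_eq v s.2) (fun s t => hK.γ_eq s.2 t.2) (hK.theta_eq hsp h h' hθ hθ'),
    shearEquiv_even ψ, shearEquiv_map_filtrationOf ψ, shearEquiv_gr ψ⟩⟩

end MemK

section

variable (Ψ : DeformationIso a.deg b b')
include Ψ

/-- The identity on the associated graded space fixes the `V`-component and evenness excludes a
spinor component. Only a shear into `𝔥` is left. -/
lemma _root_.SpencerDeformation.DeformationIso.apply_vector (v : V) :
    Ψ.toEquiv (v, 0, 0) = (v, 0, (Ψ.toEquiv (v, 0, 0)).2.2) := by
  have h1 := mem_filtrationOf_grading.mp (Ψ.gr_id (-2) _ (left_mem_grading v))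
  have h2 := mem_parityPart_zero.mp (Ψ.even 0 _ (mem_parityPart_zero.mpr rfl :
    ((v, 0, 0) : a.Carrier) ∈ parityPart a.deg 0))
  exact Prod.ext (sub_eq_zero.mp (h1.1 (by norm_num))) (Prod.ext h2 rfl)

lemma _root_.SpencerDeformation.DeformationIso.apply_spinor (s : a.odd) :
    Ψ.toEquiv (0, s, 0) = (0, s, 0) := by
  have h1 := mem_filtrationOf_grading.mp (Ψ.gr_id (-1) _ (middle_mem_grading s))
  have h2 := mem_parityPart_one.mp (Ψ.even 1 _ (mem_parityPart_one.mpr ⟨rfl, rfl⟩ :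
    ((0, s, 0) : a.Carrier) ∈ parityPart a.deg 1))
  exact Prod.ext h2.1 (Prod.ext (sub_eq_zero.mp (h1.2.1 (by norm_num))) h2.2)

lemma _root_.SpencerDeformation.DeformationIso.apply_so (A : a.zero) :
    Ψ.toEquiv (0, 0, A) = (0, 0, A) := by
  have h1 := mem_filtrationOf_grading.mp (Ψ.gr_id 0 _ (right_mem_grading A))
  exact sub_eq_zero.mp (Prod.ext (h1.1 (by norm_num)) (Prod.ext (h1.2.1 (by norm_num))
    (h1.2.2 (by norm_num))))

lemma _root_.SpencerDeformation.DeformationIso.apply_fst (x : a.Carrier) :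
    (Ψ.toEquiv x).1 = x.1 := by
  rw [prod_eq_add x, map_add, map_add, Ψ.apply_vector, Ψ.apply_spinor, Ψ.apply_so]
  rfl

lemma _root_.SpencerDeformation.DeformationIso.apply_odd (x : a.Carrier) :
    (Ψ.toEquiv x).2.1 = x.2.1 := by
  rw [prod_eq_add x, map_add, map_add, Ψ.apply_vector, Ψ.apply_spinor, Ψ.apply_so]
  rfl

lemma _root_.SpencerDeformation.DeformationIso.memK
    (hβγ : IsNormalisedCocycle κ β γ) (hβγ' : IsNormalisedCocycle κ β' γ')
    (hb : a.HasDeformedBracket κ β γ lam θ b) (hb' : a.HasDeformedBracket κ β' γ' lam' θ' b') :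
    a.MemK κ (β' - β) (γ' - γ) := by
  let ψ : V →ₗ[ℝ] so η := a.zero.toSubmodule.subtype ∘ₗ LinearMap.snd ℝ a.odd a.zero ∘ₗ
    LinearMap.snd ℝ V (a.odd × a.zero) ∘ₗ (Ψ.toEquiv : a.Carrier →ₗ[ℝ] a.Carrier) ∘ₗ
    LinearMap.inl ℝ V (a.odd × a.zero)
  have hψ : ∀ v, ((Ψ.toEquiv (v, 0, 0)).2.2 : so η) = ψ v := fun _ => rfl
  -- Comparing the `V`-components of `[v,w]` shows that this map is symmetric, so it lies in the
  -- trivial first prolongation.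
  have hμ : ψ + lam' - lam = 0 := by
    refine eq_zero_of_symmetric_so fun v w => ?_
    have h1 := congrArg (fun x => x.1) (Ψ.map_bracket (v, 0, 0) (w, 0, 0))
    simp only [Ψ.apply_fst, hb.fst_eq, hb'.fst_eq, Ψ.apply_odd, hψ] at h1
    simp only [coe_zero_zero, zero_add, Submodule.coe_zero, map_zero, add_zero] at h1
    change ((ψ v + lam' v : so η) : Module.End ℝ V) w - (lam v : Module.End ℝ V) w =
      ((ψ w + lam' w : so η) : Module.End ℝ V) v - (lam w : Module.End ℝ V) v
    rw [sub_eq_sub_iff_sub_eq_sub, ← h1]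
  refine ⟨hβγ.sub hβγ', fun v s hs => ?_⟩
  -- With `ψ + λ' = λ`, the spinor actions in `[v,s]` cancel and only `β` and `β'` remain.
  have h1 := congrArg (fun x => (x.2.1 : S)) (Ψ.map_bracket (v, 0, 0) (0, ⟨s, hs⟩, 0))
  have h2 : ψ v + lam' v = lam v := sub_eq_zero.mp (LinearMap.congr_fun hμ v)
  simp only [Ψ.apply_odd, hb.odd_eq, hb'.odd_eq, Ψ.apply_fst, hψ, h2] at h1
  simp only [coe_zero_zero, zero_add, Submodule.coe_zero, map_zero, add_zero,
    sub_zero] at h1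
  rw [LinearMap.sub_apply, LinearMap.sub_apply, sub_eq_zero]
  exact (add_left_cancel h1).symm

end

end GradedSubalgebra

end Isomorphisms

end SpencerDeformation

end

theorem theorem4p22 {V S : Type*}
    [AddCommGroup V] [Module ℝ V] [FiniteDimensional ℝ V]
    [AddCommGroup S] [Module ℝ S] [FiniteDimensional ℝ S]
    (hV : 2 < Module.finrank ℝ V)
    (η : SpencerDeformation.LorentzianForm V)
    [Module (SpencerDeformation.EvenClifford η) S]
    [IsScalarTower ℝ (SpencerDeformation.EvenClifford η) S]
    (κ : SpencerDeformation.SquaringMap η S) (hκ : κ.IsCausal)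
    (a : SpencerDeformation.GradedSubalgebra η S) (ha : a.HighlySupersymmetric) :
    (∀ (φ : a.Neg →ₗ[ℝ] a.Neg →ₗ[ℝ] a.Carrier)
        (β : V →ₗ[ℝ] S →ₗ[ℝ] S) (γ : S →ₗ[ℝ] S →ₗ[ℝ] SpencerDeformation.so η)
        (lam : V →ₗ[ℝ] SpencerDeformation.so η),
      a.IsAdmissible κ φ → a.IsIntegrable κ φ → a.IsParametrisation κ φ β γ lam →
      (∃! θ : V →ₗ[ℝ] V →ₗ[ℝ] SpencerDeformation.so η, a.FactorsTheta κ β γ lam θ) ∧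
      ∀ θ : V →ₗ[ℝ] V →ₗ[ℝ] SpencerDeformation.so η, a.FactorsTheta κ β γ lam θ →
        (∀ v, θ v v = 0) ∧
        ∃ b, a.HasDeformedBracket κ β γ lam θ b ∧ a.IsRealisableDeformation κ b) ∧
    (∀ (φ φ' : a.Neg →ₗ[ℝ] a.Neg →ₗ[ℝ] a.Carrier)
        (β β' : V →ₗ[ℝ] S →ₗ[ℝ] S) (γ γ' : S →ₗ[ℝ] S →ₗ[ℝ] SpencerDeformation.so η)
        (lam lam' : V →ₗ[ℝ] SpencerDeformation.so η)
        (θ θ' : V →ₗ[ℝ] V →ₗ[ℝ] SpencerDeformation.so η)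
        (b b' : a.Carrier →ₗ[ℝ] a.Carrier →ₗ[ℝ] a.Carrier),
      a.IsAdmissible κ φ → a.IsIntegrable κ φ → a.IsParametrisation κ φ β γ lam →
      a.FactorsTheta κ β γ lam θ → a.HasDeformedBracket κ β γ lam θ b →
      a.IsAdmissible κ φ' → a.IsIntegrable κ φ' → a.IsParametrisation κ φ' β' γ' lam' →
      a.FactorsTheta κ β' γ' lam' θ' → a.HasDeformedBracket κ β' γ' lam' θ' b' →
      (Nonempty (SpencerDeformation.DeformationIso a.deg b b') ↔
        a.MemK κ (β' - β) (γ' - γ))) := by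
  -- Causality, the dimension of `V` and high supersymmetry enter only through this surjectivity.
  have hsp : a.Spans κ := hκ.span_eq_top hV a.odd ha
  refine ⟨fun φ β γ lam hadm hint hpar => ?_, ?_⟩
  · have hcomp := hpar.isCompatible
    -- Integrability supplies its own parametrisation, so its conditions are first transferred to
    -- the given one.
    obtain ⟨hker, hcurv⟩ := hint.of_isParametrisation hpar
    obtain ⟨θ₀, hθ₀⟩ := hcomp.exists_factorsTheta hsp hker
    refine ⟨⟨θ₀, hθ₀, fun θ hθ => hθ.unique hsp hθ₀⟩, fun θ hθ => ?_⟩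
    have hcurvθ := hcurv θ hθ
    obtain ⟨b, hb⟩ := SpencerDeformation.GradedSubalgebra.exists_hasDeformedBracket hsp hcomp hθ
    exact ⟨SpencerDeformation.GradedSubalgebra.FactorsTheta.alternating hsp hcurvθ, b, hb,
      hb.isFilteredDeformation (hb.isLieSuperbracket hsp hcomp hθ hcurvθ),
      φ, hb.isDegreeTwoPart hadm.1.1 hpar, hadm⟩
  · intro φ φ' β β' γ γ' lam lam' θ θ' b b' _ _ hpar hθ hb _ _ hpar' hθ' hb'
    refine ⟨fun ⟨Ψ⟩ => Ψ.memK hpar.1 hpar'.1 hb hb', fun hK => ?_⟩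
    exact hK.nonempty_deformationIso hsp hpar.isCompatible hpar'.isCompatible hθ hθ' hb hb'
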